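/- **Non-uniform convergence of Braunstein–Kimble teleportation.** Use the conventions $[\hat q,\hat p]=i$ (vacuum variance $1/2$). For $\mu\ge 1/2$ let $\Phi^{\mu}$ be the two-mode squeezed vacuum (TMSV) state, i.e. the pure two-mode Gaussian state with zero mean and covariance matrix $\mathbf V_q\oplus \mathbf Z\mathbf V_q\mathbf Z$, where $\mathbf Z=\mathrm{diag}(1,-1)$ and $$\mathbf V_q=\begin{pmatrix}\mu & \sqrt{\mu^2-1/4}\\ \sqrt{\mu^2-1/4} & \mu\end{pmatrix}.$$ Let $\mathcal I^{\mu}$ be the Braunstein–Kimble teleportation channel with resource $\Phi^{\mu}_{a'B}$: ideal continuous-variable Bell detection of the input mode $a$ and the mode $a'$ (joint measurement of $\hat q_a-\hat q_{a'}$ and $\hat p_a+\hat p_{a'}$), followed by the correcting phase-space displacement of mode $B$, averaged over all outcomes. Let $F(\rho,\sigma)=\mathrm{Tr}\sqrt{\sqrt\rho\,\sigma\sqrt\rho}$ be the fidelity, $\|\cdot\|$ the trace norm, $\xi=2\mu-\sqrt{4\mu^2-1}$, and, for an input TMSV state $\Phi^{\tilde\mu}_{Aa}$, $$F(\mu,\tilde\mu):=F\big((\mathcal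 I_A\otimes\mathcal I^{\mu})(\Phi^{\tilde\mu}_{Aa}),\,\Phi^{\tilde\mu}_{Aa}\big).$$ Then $\Phi^{\tilde\mu}_{Aa}$ is a state for every $\tilde\mu\ge1/2$, $\mathcal I_A\otimes\mathcal I^{\mu}$ maps states to states for every ancilla $A$ and every $\mu\ge1/2$, and the following hold. 1. For all $\mu,\tilde\mu\ge 1/2$ the quantity under the root below is positive, and $$F(\mu,\tilde\mu)=\frac{1}{\sqrt[4]{1-4\tilde\mu\left[\sqrt{4\mu^2-1}+\tilde\mu-2\mu(1+2\tilde\mu\xi)\right]}}.$$ 2. For every fixed $\tilde\mu\ge 1/2$: $F(\mu,\tilde\mu)\to 1$ as $\mu\to\infty$, with $1-F(\mu,\tilde\mu)=O(\mu^{-1})$. 3. For every fixed $\mu\ge 1/2$: $F(\mu,\tilde\mu)\to 0$ as $\tilde\mu\to\infty$, with $F(\mu,\tilde\mu)=O(\tilde\mu^{-1/2})$. 4. For every $\mu\ge 1/2$, the supremum over all ancillas $A$ and all states $\rho_{Aa}$ satisfies $$\sup_{\rho_{Aa}}\big[1-F\big((\mathcal I_A\otimes\mathcal I^{\mu})(\rho_{Aa}),\rho_{Aa}\big)\big]=1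 .$$ 5. For every $\mu\ge 1/2$, $$\|\mathcal I-\mathcal I^{\mu}\|_\diamond:=\sup_{\rho_{Aa}}\big\|\rho_{Aa}-(\mathcal I_A\otimes\mathcal I^{\mu})(\rho_{Aa})\big\|=2 .$$ -/

import Mathlib

open MeasureTheory Filter Topology Asymptotics
open scoped ENNReal

noncomputable section

namespace BK

/-! ### Trace, states, trace norm and fidelity on a complex Hilbert space -/

section Operators

variable {H : Type*} [NormedAddCommGroup H] [InnerProductSpace ℂ H] [CompleteSpace H]

/-- The trace `∑ᵢ ⟨eᵢ, T eᵢ⟩ ∈ [0, ∞]` of a positive bounded operator, computed in an orthonormal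
(Hilbert) basis of `H`; for positive `T` the value does not depend on the basis. It is only applied
to positive operators below. -/
def posTrace (T : H →L[ℂ] H) : ℝ≥0∞ :=
  ∑' i, ENNReal.ofReal
    (inner ℂ ((exists_hilbertBasis ℂ H).choose_spec.choose i)
      (T ((exists_hilbertBasis ℂ H).choose_spec.choose i))).re

/-- Quantum states (density operators): positive operators of trace one. -/
structure IsState (ρ : H →L[ℂ] H) : Prop where
  isPositive : ρ.IsPositive
  posTrace_eq_one : posTrace ρ = 1

/-- The trace norm `‖T‖ = Tr √(T† T) ∈ [0, ∞]`. -/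
def traceNorm (T : H →L[ℂ] H) : ℝ≥0∞ := posTrace (CFC.sqrt (star T * T))

/-- The Bures fidelity `F(ρ, σ) = Tr √(√ρ σ √ρ)` of two states (it is at most one for states). -/
def fidelity (ρ σ : H →L[ℂ] H) : ℝ :=
  (posTrace (CFC.sqrt (CFC.sqrt ρ * σ * CFC.sqrt ρ))).toReal

/-- The rank-one operator `|ψ⟩⟨ψ|`. -/
def pureOp (ψ : H) : H →L[ℂ] H := InnerProductSpace.rankOne ℂ ψ ψ

end Operators

/-! ### A bosonic mode with an ancilla -/

section Mode

/-- The Hilbert space `A ⊗ L²(ℝ)` of an ancilla with Hilbert space `A` and one bosonic mode `a`,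
realised as the square-integrable functions of the position `q` of the mode with values in `A`. -/
abbrev Joint (A : Type*) [NormedAddCommGroup A] : Type _ := Lp A 2 (volume : Measure ℝ)

/-- The Hilbert space of one bosonic mode. -/
abbrev Mode : Type := Lp ℂ 2 (volume : Measure ℝ)

variable {A : Type*} [NormedAddCommGroup A]

open Classical in
/-- The class in `L²` of a square-integrable function (and `0` for any other function). -/
def toL2 (f : ℝ → A) : Joint A := if h : MemLp f 2 volume then h.toLp f else 0

variable [InnerProductSpace ℂ A]

theorem enorm_kernel_integral_le (k : ℝ → ℝ → ℂ) (f : ℝ → A)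
    (hf : AEStronglyMeasurable f) (b : ℝ) (hb : AEStronglyMeasurable (k b)) :
    ∫⁻ q, ‖k b q • f q‖ₑ ≤ (∫⁻ q, ‖k b q‖ₑ ^ (2:ℝ)) ^ (1/2:ℝ) * eLpNorm f 2 volume := by
  rw [eLpNorm_eq_lintegral_rpow_enorm_toReal (by norm_num) (by norm_num)]
  simp only [enorm_smul, ENNReal.toReal_ofNat]
  exact ENNReal.lintegral_mul_le_Lp_mul_Lq volume Real.HolderConjugate.two_two hb.enorm hf.enorm

theorem ae_integrable_kernel {k : ℝ → ℝ → ℂ}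
    (hk : MemLp (Function.uncurry k) 2 (volume.prod volume)) (f : Joint A) :
    ∀ᵐ b, Integrable (fun q => k b q • f q) := by
  have hm : ∀ᵐ b, AEStronglyMeasurable (k b) volume := hk.1.prodMk_left
  have hL : ∫⁻ b, ∫⁻ q, ‖k b q‖ₑ ^ (2:ℝ) ≠ ∞ := by
    have := lintegral_rpow_enorm_lt_top_of_eLpNorm_lt_top (by norm_num) (by norm_num) hk.2
    simp only [ENNReal.toReal_ofNat] at this
    rw [lintegral_prod _ (hk.1.enorm.pow_const _)] at this
    exact this.ne
  have hfin : ∀ᵐ b, ∫⁻ q, ‖k b q‖ₑ ^ (2:ℝ) < ∞ :=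
    ae_lt_top' ((hk.1.enorm.pow_const _).lintegral_prod_right') hL
  filter_upwards [hm, hfin] with b h1 h2
  refine ⟨h1.smul (Lp.aestronglyMeasurable f), ?_⟩
  refine (enorm_kernel_integral_le k f (Lp.aestronglyMeasurable f) b h1).trans_lt ?_
  exact ENNReal.mul_lt_top (ENNReal.rpow_lt_top_of_nonneg (by norm_num) h2.ne) (Lp.memLp f).2

theorem eLpNorm_kernel_le {k : ℝ → ℝ → ℂ}
    (hk : MemLp (Function.uncurry k) 2 (volume.prod volume)) (f : Joint A) :
    eLpNorm (fun b => ∫ q, k b q • f q) 2 volume ≤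
      eLpNorm (Function.uncurry k) 2 (volume.prod volume) * eLpNorm f 2 volume := by
  have hm : ∀ᵐ b, AEStronglyMeasurable (k b) volume := hk.1.prodMk_left
  rw [eLpNorm_eq_lintegral_rpow_enorm_toReal (by norm_num) (by norm_num),
    eLpNorm_eq_lintegral_rpow_enorm_toReal (f := Function.uncurry k) (by norm_num) (by norm_num)]
  simp only [ENNReal.toReal_ofNat]
  rw [lintegral_prod _ (hk.1.enorm.pow_const _)]
  have key : ∫⁻ b, ‖∫ q, k b q • f q‖ₑ ^ (2:ℝ) ≤
      (∫⁻ b, ∫⁻ q, ‖Function.uncurry k (b, q)‖ₑ ^ (2:ℝ)) * eLpNorm f 2 volume ^ (2:ℝ) := by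
    rw [← lintegral_mul_const' _ _
      (ENNReal.rpow_lt_top_of_nonneg (by norm_num) (Lp.memLp f).2.ne).ne]
    refine lintegral_mono_ae ?_
    filter_upwards [hm] with b hb
    calc ‖∫ q, k b q • f q‖ₑ ^ (2:ℝ)
        ≤ ((∫⁻ q, ‖k b q‖ₑ ^ (2:ℝ)) ^ (1/2:ℝ) * eLpNorm f 2 volume) ^ (2:ℝ) :=
          ENNReal.rpow_le_rpow ((enorm_integral_le_lintegral_enorm _).trans
            (enorm_kernel_integral_le k f (Lp.aestronglyMeasurable f) b hb)) (by norm_num)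
      _ = _ := by
          rw [ENNReal.mul_rpow_of_nonneg _ _ (by norm_num), ← ENNReal.rpow_mul]
          norm_num
  calc _ ≤ ((∫⁻ b, ∫⁻ q, ‖Function.uncurry k (b, q)‖ₑ ^ (2:ℝ)) *
        eLpNorm f 2 volume ^ (2:ℝ)) ^ (1/2:ℝ) := ENNReal.rpow_le_rpow key (by norm_num)
    _ = _ := by
          rw [ENNReal.mul_rpow_of_nonneg _ _ (by norm_num), ← ENNReal.rpow_mul]
          norm_num

theorem memLp_kernel {k : ℝ → ℝ → ℂ}
    (hk : MemLp (Function.uncurry k) 2 (volume.prod volume)) (f : Joint A) :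
    MemLp (fun b => ∫ q, k b q • f q) 2 volume := by
  refine ⟨?_, (eLpNorm_kernel_le hk f).trans_lt (ENNReal.mul_lt_top hk.2 (Lp.memLp f).2)⟩
  exact (hk.1.smul (Lp.aestronglyMeasurable f).comp_snd).integral_prod_right'

/-- `1_A ⊗ T` on `A ⊗ L²(ℝ)`, where `(T f)(b) = ∫ k b q f(q) dq` is the integral operator with
square-integrable kernel `k`. -/
def kernelOpOfMemLp (A : Type*) [NormedAddCommGroup A] [InnerProductSpace ℂ A]
    {k : ℝ → ℝ → ℂ}
    (hk : MemLp (Function.uncurry k) 2 (volume.prod volume)) :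
    Joint A →L[ℂ] Joint A :=
  LinearMap.mkContinuous
    { toFun := fun f => (memLp_kernel hk f).toLp _
      map_add' := fun f g => by
        rw [← MemLp.toLp_add]
        refine MemLp.toLp_congr _ _ ?_
        filter_upwards [ae_integrable_kernel hk f, ae_integrable_kernel hk g] with b h1 h2
        rw [Pi.add_apply, ← integral_add h1 h2]
        refine integral_congr_ae ?_
        filter_upwards [Lp.coeFn_add f g] with q hq
        rw [hq, Pi.add_apply, smul_add]
      map_smul' := fun c f => by
        rw [← MemLp.toLp_const_smul]
        refine MemLp.toLp_congr _ _ (Eventually.of_forall fun b => ?_)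
        simp only [Pi.smul_apply, RingHom.id_apply]
        rw [← integral_smul]
        refine integral_congr_ae ?_
        filter_upwards [Lp.coeFn_smul c f] with q hq
        rw [hq, Pi.smul_apply, smul_comm] }
    (eLpNorm (Function.uncurry k) 2 (volume.prod volume)).toReal
    (fun f => by
      simp only [LinearMap.coe_mk, AddHom.coe_mk, Lp.norm_def]
      rw [← ENNReal.toReal_mul]
      exact ENNReal.toReal_mono (ENNReal.mul_lt_top hk.2 (Lp.memLp f).2).ne
        ((eLpNorm_congr_ae (MemLp.coeFn_toLp _)).trans_le (eLpNorm_kernel_le hk f)))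

open Classical in
/-- `1_A ⊗ T` for the integral operator `T` with kernel `k`; the value `0` is only taken by kernels
that are not square-integrable. -/
def kernelOp (A : Type*) [NormedAddCommGroup A] [InnerProductSpace ℂ A] (k : ℝ → ℝ → ℂ) :
    Joint A →L[ℂ] Joint A :=
  if hk : MemLp (Function.uncurry k) 2 (volume.prod volume) then kernelOpOfMemLp A hk else 0

end Mode

/-! ### Two-mode squeezed vacuum states -/

/-- The wave function `φ(q₁, q₂)` of the two-mode squeezed vacuum state (TMSV) with parameter
`μ ≥ 1/2` (conventions `[q, p] = i`, vacuum variance `1/2`):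
`φ(q₁, q₂) = π^{-1/2} exp (-μ (q₁² + q₂²) + 2 √(μ² - 1/4) q₁ q₂)`.
This is the pure Gaussian state with zero mean, position covariance matrix
`[[μ, c], [c, μ]]` and momentum covariance matrix `[[μ, -c], [-c, μ]]`, where `c = √(μ² - 1/4)`. -/
def tmsvWave (μ q₁ q₂ : ℝ) : ℂ :=
  (((Real.sqrt Real.pi)⁻¹ *
    Real.exp (-μ * (q₁ ^ 2 + q₂ ^ 2) + 2 * Real.sqrt (μ ^ 2 - 1 / 4) * q₁ * q₂) : ℝ) : ℂ)

/-- The TMSV state vector of the modes `A` (the ancilla) and `a`, in `L²(ℝ) ⊗ L²(ℝ)`. -/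
def tmsvVec (μ : ℝ) : Joint Mode := toL2 fun q => toL2 fun s => tmsvWave μ s q

/-- The TMSV state `Φ^μ` of the modes `A` and `a`. -/
def tmsv (μ : ℝ) : Joint Mode →L[ℂ] Joint Mode := pureOp (tmsvVec μ)

/-! ### The Braunstein–Kimble protocol

The mode `a` and the mode `a'` of the resource TMSV state `Φ^μ` of the modes `a'` and `B` undergo
the ideal continuous-variable Bell detection, that is the joint measurement of the commuting
quadratures `q_a - q_a'` and `p_a + p_a'` (the outputs of a balanced beam splitter measured by two
conjugate homodyne detectors, up to a factor `√2` in the units of the outcomes). Its outcomes are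
the pairs `(x, y) ∈ ℝ²`, and its generalised eigenfunctions, normalised with respect to `dx dy`, are
`(2π)^{-1/2} exp (i y q) δ(q - q' - x)` in the positions `q` of `a` and `q'` of `a'`. -/

/-- The kernel of the operator which maps a state vector of `a` to the unnormalised state vector of
`B` conditional on the Bell outcome `(x, y)`: the pairing over `a` and `a'` of the Bell
eigenfunction (conjugated) with `ψ(q) φ(q', b)` is `∫ bellKernel μ x y b q * ψ(q) dq`. -/
def bellKernel (μ x y b q : ℝ) : ℂ :=
  ((Real.sqrt (2 * Real.pi))⁻¹ : ℝ) * Complex.exp (-(Complex.I * y * q)) * tmsvWave μ (q - x) b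

/-- The phase-space displacement by `(x, y)`, that is `exp (i (y q̂ - x p̂))`, on wave functions. -/
def displace (x y : ℝ) (g : ℝ → ℂ) (b : ℝ) : ℂ :=
  Complex.exp (Complex.I * (y * b - x * y / 2)) * g (b - x)

/-- The operator `1_A ⊗ K_z` which maps a state vector of `A` and `a` to the unnormalised state
vector of `A` and `B` after the Bell outcome `z = (x, y)` and Bob's correcting displacement. -/
def krausOp (A : Type*) [NormedAddCommGroup A] [InnerProductSpace ℂ A] (μ : ℝ) (z : ℝ × ℝ) :
    Joint A →L[ℂ] Joint A :=
  kernelOp A fun b q => displace z.1 z.2 (fun b' => bellKernel μ z.1 z.2 b' q) b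

/-- A channel `ℰ` on one mode, given through the maps `𝓘_A ⊗ ℰ` for all ancillas `A`. -/
abbrev ModeChannel : Type 1 :=
  ∀ (A : Type) [NormedAddCommGroup A] [InnerProductSpace ℂ A] [CompleteSpace A],
    (Joint A →L[ℂ] Joint A) → (Joint A →L[ℂ] Joint A)

/-- The identity channel `𝓘`. -/
def idChannel : ModeChannel := fun _ _ _ _ ρ => ρ

/-- The BK teleportation channel `𝓘^μ`: the output state averaged over all Bell outcomes. -/
def bkChannel (μ : ℝ) : ModeChannel := fun A _ _ _ ρ =>
  ∫ z : ℝ × ℝ, (krausOp A μ z).comp (ρ.comp (ContinuousLinearMap.adjoint (krausOp A μ z)))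

/-! ### Distances between channels -/

/-- The diamond distance: the supremum of `‖(𝓘_A ⊗ ℰ₁)(ρ) - (𝓘_A ⊗ ℰ₂)(ρ)‖` (trace norm) over all
ancillas `A` and all states `ρ` of `A` and `a`. -/
def diamondDist (E₁ E₂ : ModeChannel) : ℝ≥0∞ :=
  ⨆ (A : Type) (_ : NormedAddCommGroup A) (_ : InnerProductSpace ℂ A) (_ : CompleteSpace A)
    (ρ : Joint A →L[ℂ] Joint A) (_ : IsState ρ), traceNorm (E₁ A ρ - E₂ A ρ)

/-- The set of all teleportation infidelities `1 - F((𝓘_A ⊗ 𝓘^μ)(ρ), ρ)`, over all ancillas `A`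
and all states `ρ` of `A` and `a`. -/
def infidelities (μ : ℝ) : Set ℝ :=
  {e | ∃ (A : Type) (_ : NormedAddCommGroup A) (_ : InnerProductSpace ℂ A) (_ : CompleteSpace A)
    (ρ : Joint A →L[ℂ] Joint A), IsState ρ ∧ e = 1 - fidelity (bkChannel μ A ρ) ρ}

/-- The fidelity `F(μ, ν)` between the output of the BK channel `𝓘^μ` and the ideal output, for the
TMSV state with parameter `ν` at the input. -/
def tmsvFidelity (μ ν : ℝ) : ℝ := fidelity (bkChannel μ Mode (tmsv ν)) (tmsv ν)

/-- The added noise `ξ = 2 μ - √(4 μ² - 1)` of the BK protocol. -/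
def addedNoise (μ : ℝ) : ℝ := 2 * μ - Real.sqrt (4 * μ ^ 2 - 1)

end BK

end

/-! Write c = √(μ² - 1/4), m = μ - c and ξ = 2m. For the Bell outcome z = (x, y), Bob's corrected
output is K_z f, where the kernel of K_z is a phase times (2π)^{-1/2} times the resource wave
function translated by x in both arguments. As a function of y, K_z f is a Fourier transform up to a
phase, so Plancherel removes all phases; integrating over the output position and then over x leaves
the total mass of a TMSV marginal, which is 1. Hence ∫ K_z† K_z dz = 1
(`lintegral_enorm_krausOp_sq`), and together with norm continuity of z ↦ K_z this makes the Bochner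
integral ∫ K_z ρ K_z† dz a state (`isState_integral_kraus_conj`).

Against a pure state ψ the fidelity is √⟨ψ, ρψ⟩ (`fidelity_pureOp`), so for the TMSV vector ψ with
parameter ν everything rests on ∫ |⟨ψ, K_z ψ⟩|² dz. The integrand of ⟨ψ, K_z ψ⟩ splits into Gaussian
factors in b + q and b - q; the squared modulus is Gaussian in z and integrates to 1/(1 + 2νξ). So F
= (1 + 2νξ)^{-1/2}, and the stated radicand is (1 + 2νξ)² because ξ² = 4μξ - 1.

Since 0 < ξ ≤ 1/μ, the product νξ vanishes when μ grows at fixed ν and diverges when ν grows at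
fixed μ: the limits do not commute. At fixed μ, TMSV inputs therefore drive the infidelity to 1 and,
through ‖ |ψ⟩⟨ψ| - σ ‖ ≥ 2(1 - F²) (`le_traceNorm_pureOp_sub`), the trace norm to 2, the largest
value possible for two states (`traceNorm_sub_le_two`). -/

namespace BK

/-! ### Traces of positive operators through Hilbert–Schmidt norms -/

section HilbertSchmidt

theorem ofReal_norm_sq {H : Type*} [NormedAddCommGroup H] (x : H) : ENNReal.ofReal (‖x‖ ^ 2) = ‖x‖ₑ ^ 2 := by
  rw [ENNReal.ofReal_pow (norm_nonneg _), ofReal_norm]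

variable {H : Type*} [NormedAddCommGroup H] [InnerProductSpace ℂ H]

theorem enorm_sq_eq_tsum {ι : Type*} (b : HilbertBasis ι ℂ H) (x : H) :
    ‖x‖ₑ ^ 2 = ∑' i, ‖inner ℂ (b i) x‖ₑ ^ 2 := by
  have h := b.hasSum_inner_mul_inner x x
  have h2 : HasSum (fun i => ‖inner ℂ (b i) x‖ ^ 2) (‖x‖ ^ 2) := by
    have := Complex.hasSum_re h
    rw [inner_self_eq_norm_sq_to_K] at this
    convert this using 1
    · ext i
      rw [← inner_conj_symm x (b i), mul_comm, Complex.mul_conj, Complex.normSq_eq_norm_sq]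
      norm_cast
    · norm_cast
  rw [← ofReal_norm_sq, ← h2.tsum_eq, ENNReal.ofReal_tsum_of_nonneg (fun _ => by positivity)
    h2.summable]
  exact tsum_congr fun i => ofReal_norm_sq _

variable [CompleteSpace H]

variable (H) in
/-- The Hilbert basis in which `posTrace` is computed. -/
noncomputable def traceBasis :
    HilbertBasis (exists_hilbertBasis ℂ H).choose ℂ H :=
  (exists_hilbertBasis ℂ H).choose_spec.choose

/-- The square of the Hilbert–Schmidt norm. -/
noncomputable def hsSq (T : H →L[ℂ] H) : ℝ≥0∞ := ∑' i, ‖T (traceBasis H i)‖ₑ ^ 2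

theorem posTrace_eq_tsum (T : H →L[ℂ] H) : posTrace T =
    ∑' i, ENNReal.ofReal (inner ℂ (traceBasis H i) (T (traceBasis H i))).re := rfl

/-- By Parseval both sides are the double sum of |⟨e_i, T e_j⟩|², and Tonelli swaps the indices.
This plays the role of cyclicity of the trace. -/
theorem hsSq_adjoint (T : H →L[ℂ] H) : hsSq (ContinuousLinearMap.adjoint T) = hsSq T := by
  unfold hsSq
  simp_rw [fun x => enorm_sq_eq_tsum (traceBasis H) (ContinuousLinearMap.adjoint T x),
    ContinuousLinearMap.adjoint_inner_right]
  rw [ENNReal.tsum_comm]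
  refine tsum_congr fun i => ?_
  rw [enorm_sq_eq_tsum (traceBasis H)]
  refine tsum_congr fun j => ?_
  rw [← inner_conj_symm, ← ofReal_norm, ← ofReal_norm, RCLike.norm_conj]

theorem posTrace_adjoint_mul (T : H →L[ℂ] H) :
    posTrace (ContinuousLinearMap.adjoint T * T) = hsSq T := by
  rw [posTrace_eq_tsum]
  refine tsum_congr fun i => ?_
  rw [ContinuousLinearMap.mul_def, ContinuousLinearMap.comp_apply, ContinuousLinearMap.adjoint_inner_right,
    inner_self_eq_norm_sq_to_K, ← ofReal_norm_sq]
  norm_cast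

theorem isSelfAdjoint_sqrt (T : H →L[ℂ] H) : IsSelfAdjoint (CFC.sqrt T) :=
  (CFC.sqrt_nonneg T).isSelfAdjoint

theorem adjoint_sqrt (T : H →L[ℂ] H) : ContinuousLinearMap.adjoint (CFC.sqrt T) = CFC.sqrt T :=
  isSelfAdjoint_sqrt T

theorem sqrt_comp_sqrt {T : H →L[ℂ] H} (hT : T.IsPositive) : CFC.sqrt T * CFC.sqrt T = T :=
  CFC.sqrt_mul_sqrt_self T ((ContinuousLinearMap.nonneg_iff_isPositive T).2 hT)

theorem inner_eq_norm_sqrt_sq {T : H →L[ℂ] H} (hT : T.IsPositive) (x : H) :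
    inner ℂ x (T x) = ((‖CFC.sqrt T x‖ ^ 2 : ℝ) : ℂ) := by
  conv_lhs => rw [← sqrt_comp_sqrt hT, ContinuousLinearMap.mul_def, ContinuousLinearMap.comp_apply, ← adjoint_sqrt T,
    ContinuousLinearMap.adjoint_inner_right, adjoint_sqrt, inner_self_eq_norm_sq_to_K]
  norm_cast

theorem posTrace_eq_hsSq {T : H →L[ℂ] H} (hT : T.IsPositive) : posTrace T = hsSq (CFC.sqrt T) := by
  rw [← posTrace_adjoint_mul, adjoint_sqrt, sqrt_comp_sqrt hT]

theorem posTrace_conj {T : H →L[ℂ] H} (hT : T.IsPositive) (K : H →L[ℂ] H) :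
    posTrace (ContinuousLinearMap.adjoint K * T * K) = hsSq (CFC.sqrt T * K) := by
  rw [← posTrace_adjoint_mul, ← ContinuousLinearMap.star_eq_adjoint,
    ← ContinuousLinearMap.star_eq_adjoint, star_mul, (isSelfAdjoint_sqrt T).star_eq]
  conv_lhs => rw [← sqrt_comp_sqrt hT]
  simp only [mul_assoc]

theorem posTrace_add {S T : H →L[ℂ] H} (hS : S.IsPositive) (hT : T.IsPositive) :
    posTrace (S + T) = posTrace S + posTrace T := by
  simp only [posTrace_eq_tsum]
  rw [← ENNReal.tsum_add]
  refine tsum_congr fun i => ?_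
  rw [← ENNReal.ofReal_add (hS.inner_nonneg_right _ |> fun h => (Complex.le_def.1 h).1)
    (hT.inner_nonneg_right _ |> fun h => (Complex.le_def.1 h).1)]
  simp

theorem posTrace_mono {S T : H →L[ℂ] H}
    (h : ∀ x, (inner ℂ x (S x)).re ≤ (inner ℂ x (T x)).re) : posTrace S ≤ posTrace T :=
  ENNReal.tsum_le_tsum fun _ => ENNReal.ofReal_le_ofReal (h _)

/-- Parseval on T x and Cauchy–Schwarz on ⟨T† e_i, x⟩ bound the left side by the Hilbert–Schmidt
norm of T†, so x need not belong to the trace basis. -/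
theorem enorm_sq_le_hsSq (T : H →L[ℂ] H) {x : H} (hx : ‖x‖ ≤ 1) : ‖T x‖ₑ ^ 2 ≤ hsSq T := by
  rw [← hsSq_adjoint, enorm_sq_eq_tsum (traceBasis H)]
  refine ENNReal.tsum_le_tsum fun i => ?_
  rw [← ContinuousLinearMap.adjoint_inner_left]
  gcongr
  rw [← ofReal_norm, ← ofReal_norm]
  refine ENNReal.ofReal_le_ofReal ((norm_inner_le_norm _ _).trans ?_)
  exact mul_le_of_le_one_right (norm_nonneg _) hx

theorem opNorm_enorm_sq_le_hsSq (T : H →L[ℂ] H) : ‖T‖ₑ ^ 2 ≤ hsSq T := by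
  rcases eq_or_ne (hsSq T) ∞ with h | h
  · simp [h]
  have h1 : ‖T‖ ≤ √(hsSq T).toReal := by
    refine T.opNorm_le_of_unit_norm (Real.sqrt_nonneg _) fun x hx => ?_
    refine Real.le_sqrt_of_sq_le ?_
    have := ENNReal.toReal_mono h (enorm_sq_le_hsSq T hx.le)
    simpa using this
  rw [← ENNReal.ofReal_toReal h, ← ofReal_norm, ← ENNReal.ofReal_pow (norm_nonneg _)]
  refine ENNReal.ofReal_le_ofReal ?_
  calc ‖T‖ ^ 2 ≤ √(hsSq T).toReal ^ 2 := by gcongr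
    _ = _ := Real.sq_sqrt ENNReal.toReal_nonneg

theorem ofReal_inner_le_posTrace {T : H →L[ℂ] H} (hT : T.IsPositive) {x : H} (hx : ‖x‖ ≤ 1) :
    ENNReal.ofReal (inner ℂ x (T x)).re ≤ posTrace T := by
  rw [inner_eq_norm_sqrt_sq hT, Complex.ofReal_re, ofReal_norm_sq, posTrace_eq_hsSq hT]
  exact enorm_sq_le_hsSq _ hx

theorem hsSq_mul_le (P T : H →L[ℂ] H) (hP : ∀ x, ‖P x‖ ≤ ‖x‖) : hsSq (P * T) ≤ hsSq T := by
  refine ENNReal.tsum_le_tsum fun i => ?_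
  rw [ContinuousLinearMap.mul_def, ContinuousLinearMap.comp_apply, ← ofReal_norm_sq, ← ofReal_norm_sq]
  gcongr
  exact hP _

/-- The left side is the squared Hilbert–Schmidt norm of √T P. Passing to the adjoint P √T puts the
contraction on the left, where it shrinks each vector of the sum. -/
theorem posTrace_conj_le {T : H →L[ℂ] H} (hT : T.IsPositive) (P : H →L[ℂ] H)
    (hP : IsSelfAdjoint P) (hP' : ∀ x, ‖P x‖ ≤ ‖x‖) : posTrace (P * T * P) ≤ posTrace T := by
  have h := posTrace_conj hT P
  rw [← ContinuousLinearMap.star_eq_adjoint, hP.star_eq] at h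
  rw [h, ← hsSq_adjoint, ← ContinuousLinearMap.star_eq_adjoint, star_mul, hP.star_eq,
    (isSelfAdjoint_sqrt T).star_eq, posTrace_eq_hsSq hT]
  exact hsSq_mul_le _ _ hP'

end HilbertSchmidt

/-! ### Pure states and their fidelity -/

section PureStates

variable {H : Type*} [NormedAddCommGroup H] [InnerProductSpace ℂ H]

theorem pureOp_apply (ψ x : H) : pureOp ψ x = inner ℂ ψ x • ψ := rfl

theorem pureOp_isPositive (ψ : H) : (pureOp ψ).IsPositive :=
  InnerProductSpace.isPositive_rankOne_self ψ

variable [CompleteSpace H]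

theorem posTrace_pureOp (ψ : H) : posTrace (pureOp ψ) = ‖ψ‖ₑ ^ 2 := by
  rw [posTrace_eq_tsum, enorm_sq_eq_tsum (traceBasis H)]
  refine tsum_congr fun i => ?_
  rw [pureOp_apply, inner_smul_right, ← ofReal_norm_sq, ← inner_conj_symm, mul_comm,
    Complex.mul_conj, Complex.normSq_eq_norm_sq, Complex.ofReal_re]

theorem isState_pureOp {ψ : H} (h : ‖ψ‖ = 1) : IsState (pureOp ψ) where
  isPositive := pureOp_isPositive ψ
  posTrace_eq_one := by rw [posTrace_pureOp, ← ofReal_norm_sq, h]; simp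

theorem mul_pureOp_mul {S : H →L[ℂ] H} (hS : IsSelfAdjoint S) (ψ : H) :
    S * pureOp ψ * S = pureOp (S ψ) := by
  ext x
  have : ContinuousLinearMap.adjoint S = S := hS
  simp only [ContinuousLinearMap.mul_def, ContinuousLinearMap.comp_apply, pureOp_apply, map_smul]
  rw [← ContinuousLinearMap.adjoint_inner_left, this]

/-- The square of |v⟩⟨v| is ‖v‖² |v⟩⟨v|, and positive square roots are unique. The convention 0⁻¹ =
0 covers v = 0. -/
theorem sqrt_pureOp (v : H) : CFC.sqrt (pureOp v) = ((‖v‖⁻¹ : ℝ) : ℂ) • pureOp v := by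
  refine CFC.sqrt_unique ?_ ?_
  · rcases eq_or_ne v 0 with rfl | hv
    · ext x; simp [pureOp_apply]
    ext x
    have : ((‖v‖ : ℝ) : ℂ) ≠ 0 := by simpa using hv
    simp only [ContinuousLinearMap.mul_def, ContinuousLinearMap.comp_apply, pureOp_apply, smul_apply,
      inner_smul_right, smul_smul, inner_self_eq_norm_sq_to_K]
    congr 1
    push_cast
    simp only [Complex.coe_algebraMap]
    field_simp
  · rw [ContinuousLinearMap.nonneg_iff_isPositive]
    refine (pureOp_isPositive v).smul_of_nonneg ?_
    exact Complex.zero_le_real.2 (by positivity)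

/-- The fidelity with a pure state is the square root of the overlap. -/
theorem fidelity_pureOp {ρ : H →L[ℂ] H} (hρ : ρ.IsPositive) (ψ : H) :
    fidelity ρ (pureOp ψ) = √(inner ℂ ψ (ρ ψ)).re := by
  -- √ρ |ψ⟩⟨ψ| √ρ is the rank-one operator of v = √ρ ψ; its root has trace ‖v‖, and ‖v‖² = ⟨ψ, ρψ⟩.
  rw [fidelity, mul_pureOp_mul (isSelfAdjoint_sqrt ρ), sqrt_pureOp, inner_eq_norm_sqrt_sq hρ]
  set v := CFC.sqrt ρ ψ
  rw [Complex.ofReal_re, Real.sqrt_sq (norm_nonneg _)]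
  have h : posTrace (((‖v‖⁻¹ : ℝ) : ℂ) • pureOp v) = ENNReal.ofReal ‖v‖⁻¹ * posTrace (pureOp v) := by
    rw [posTrace_eq_tsum, posTrace_eq_tsum, ← ENNReal.tsum_mul_left]
    refine tsum_congr fun i => ?_
    rw [← ENNReal.ofReal_mul (by positivity), smul_apply, inner_smul_right,
      Complex.re_ofReal_mul]
  rw [h, posTrace_pureOp, ENNReal.toReal_mul, ENNReal.toReal_ofReal (by positivity)]
  rcases eq_or_ne ‖v‖ 0 with hv | hv
  · simp [hv]
  · simp only [ENNReal.toReal_pow, toReal_enorm]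
    field_simp

end PureStates

/-! ### Bounds on the trace norm of a difference of states -/

section TraceNorm

variable {H : Type*} [NormedAddCommGroup H] [InnerProductSpace ℂ H] [CompleteSpace H]

theorem isPositive_posPart (T : H →L[ℂ] H) : (T⁺).IsPositive :=
  (ContinuousLinearMap.nonneg_iff_isPositive _).1 (CFC.posPart_nonneg T)

theorem isPositive_negPart (T : H →L[ℂ] H) : (T⁻).IsPositive :=
  (ContinuousLinearMap.nonneg_iff_isPositive _).1 (CFC.negPart_nonneg T)

theorem traceNorm_eq {T : H →L[ℂ] H} (hT : IsSelfAdjoint T) :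
    traceNorm T = posTrace T⁺ + posTrace T⁻ := by
  rw [← posTrace_add (isPositive_posPart T) (isPositive_negPart T),
    CFC.posPart_add_negPart T hT]
  rfl

/-- The positive part of `ρ - σ` has trace at most `Tr ρ`. -/
theorem posTrace_posPart_sub_le {ρ σ : H →L[ℂ] H} (hρ : ρ.IsPositive) (hσ : σ.IsPositive) :
    posTrace (ρ - σ)⁺ ≤ posTrace ρ := by
  set T := ρ - σ with hT
  have hTs : IsSelfAdjoint T := hρ.isSelfAdjoint.sub hσ.isSelfAdjoint
  have hnp : ∀ x, T⁻ (T⁺ x) = 0 := fun x => by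
    exact congrArg (fun S : H →L[ℂ] H => S x) (CFC.negPart_mul_posPart T)
  -- P projects onto the closed range of T⁺. As T⁻ T⁺ = 0, T⁻ vanishes there, so T⁺ = P T P = PρP -
  -- PσP ≤ PρP, whose trace is at most that of ρ.
  let M : Submodule ℂ H := (T⁺.range).topologicalClosure
  have hMc : IsClosed (M : Set H) := Submodule.isClosed_topologicalClosure _
  have : CompleteSpace M := hMc.completeSpace_coe
  let P : H →L[ℂ] H := M.starProjection
  have hPs : IsSelfAdjoint P := isSelfAdjoint_starProjection M
  have hPp : ∀ x, P (T⁺ x) = T⁺ x := fun x =>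
    M.starProjection_eq_self_iff.2 (Submodule.le_topologicalClosure _ ⟨x, rfl⟩)
  have hnP : ∀ x, T⁻ (P x) = 0 := by
    intro x
    have hker : M ≤ LinearMap.ker (T⁻ : H →L[ℂ] H).toLinearMap := by
      refine Submodule.topologicalClosure_minimal _ ?_ (ContinuousLinearMap.isClosed_ker T⁻)
      rintro _ ⟨y, rfl⟩
      exact hnp y
    exact hker (M.starProjection_apply_mem x)
  refine le_trans (posTrace_mono fun x => ?_) (posTrace_conj_le hρ P hPs
    (fun x => M.norm_starProjection_apply_le x))
  have hPa : ContinuousLinearMap.adjoint P = P := hPs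
  have hPT : P * T⁺ = T⁺ := by ext y; exact hPp y
  have hPT' : ∀ y, T⁺ (P y) = T⁺ y := fun y => by
    have := congrArg star hPT
    rw [star_mul, hPs.star_eq, (isPositive_posPart T).isSelfAdjoint.star_eq] at this
    exact congrArg (fun S : H →L[ℂ] H => S y) this
  have h1 : inner ℂ x (T⁺ x) = inner ℂ (P x) (T⁺ (P x)) := by
    rw [hPT', ← hPa, ContinuousLinearMap.adjoint_inner_left, hPp]
  have h2 : T⁺ (P x) = ρ (P x) - σ (P x) := by
    have := congrArg (fun S : H →L[ℂ] H => S (P x)) (CFC.posPart_sub_negPart T hTs)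
    simp only [sub_apply, hnP, sub_zero] at this
    rw [this, hT, sub_apply]
  rw [h1, h2, inner_sub_right, Complex.sub_re, ContinuousLinearMap.mul_def, ContinuousLinearMap.comp_apply,
    ContinuousLinearMap.mul_def, ContinuousLinearMap.comp_apply]
  have h3 : inner ℂ x (P (ρ (P x))) = inner ℂ (P x) (ρ (P x)) := by
    rw [← hPa, ContinuousLinearMap.adjoint_inner_right, hPa]
  rw [h3]
  have := (Complex.le_def.1 (hσ.inner_nonneg_right (P x))).1
  simp only [Complex.zero_re] at this
  linarith

theorem traceNorm_sub_le_two {ρ σ : H →L[ℂ] H} (hρ : IsState ρ) (hσ : IsState σ) :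
    traceNorm (ρ - σ) ≤ 2 := by
  rw [traceNorm_eq (hρ.1.isSelfAdjoint.sub hσ.1.isSelfAdjoint), ← one_add_one_eq_two]
  refine add_le_add ?_ ?_
  · exact (posTrace_posPart_sub_le hρ.1 hσ.1).trans_eq hρ.2
  · rw [← CFC.posPart_neg, neg_sub]
    exact (posTrace_posPart_sub_le hσ.1 hρ.1).trans_eq hσ.2

/-- A lower bound on the trace distance to a pure state. -/
theorem le_traceNorm_pureOp_sub {ρ : H →L[ℂ] H} (hρ : IsState ρ) {ψ : H} (hψ : ‖ψ‖ = 1) :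
    ENNReal.ofReal (2 * (1 - (inner ℂ ψ (ρ ψ)).re)) ≤ traceNorm (pureOp ψ - ρ) := by
  have hσ := isState_pureOp hψ
  set T := pureOp ψ - ρ with hT
  have hTs : IsSelfAdjoint T := hσ.1.isSelfAdjoint.sub hρ.1.isSelfAdjoint
  have hp := isPositive_posPart T
  have hn := isPositive_negPart T
  -- T has trace zero, so its two parts have equal trace. Traces live in [0, ∞], hence the identity
  -- is rearranged into sums and the finite value 1 is cancelled.
  have h1 : posTrace T⁺ = posTrace T⁻ := by
    have h : T⁺ + ρ = T⁻ + pureOp ψ := by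
      have := CFC.posPart_sub_negPart T hTs
      rw [sub_eq_iff_eq_add] at this
      rw [this, hT]; abel
    have := congrArg posTrace h
    rw [posTrace_add hp hρ.1, posTrace_add hn hσ.1, hρ.2, hσ.2] at this
    exact (ENNReal.add_left_inj ENNReal.one_ne_top).1 this
  rw [traceNorm_eq hTs, ← h1, ← two_mul, ENNReal.ofReal_mul zero_le_two, ENNReal.ofReal_ofNat]
  gcongr
  -- It suffices to test T⁺ on ψ: ⟨ψ, T⁺ψ⟩ ≥ ⟨ψ, Tψ⟩ = 1 - ⟨ψ, ρψ⟩.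
  refine le_trans (ENNReal.ofReal_le_ofReal ?_) (ofReal_inner_le_posTrace hp hψ.le)
  have h2 : T⁺ ψ = ψ - ρ ψ + T⁻ ψ := by
    have := congrArg (fun S : H →L[ℂ] H => S ψ) (CFC.posPart_sub_negPart T hTs)
    simp only [sub_apply, sub_eq_iff_eq_add] at this
    rw [this, hT, sub_apply, pureOp_apply, inner_self_eq_norm_sq_to_K, hψ]
    simp
  rw [h2, inner_add_right, inner_sub_right, inner_self_eq_norm_sq_to_K, hψ]
  have := (Complex.le_def.1 (hn.inner_nonneg_right ψ)).1
  simp only [Complex.zero_re] at this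
  simpa using this

end TraceNorm

end BK

namespace BK

/-! ### Plancherel for Hilbert-space-valued functions -/

section Plancherel

open FourierTransform SchwartzMap

variable {A : Type*} [NormedAddCommGroup A] [InnerProductSpace ℂ A] [CompleteSpace A]

/-- The Fourier transform on `L²` is given by the Fourier integral on `L¹ ∩ L²`. -/
theorem coeFn_fourier_toLp {g : ℝ → A} (h1 : Integrable g) (h2 : MemLp g 2) :
    ⇑(𝓕 (h2.toLp g) : Lp A 2 (volume : Measure ℝ)) =ᵐ[volume] 𝓕 g := by
  have hcont : Continuous (𝓕 g) :=
    VectorFourier.fourierIntegral_continuous Real.continuous_fourierChar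
      (by exact continuous_inner) h1
  -- Both functions are tested against smooth compactly supported f: the L² transform agrees with
  -- the distributional one, and Fubini moves the Fourier integral from f to g.
  refine ae_eq_of_integral_contDiff_smul_eq
    ((Lp.memLp _).locallyIntegrable one_le_two) hcont.locallyIntegrable fun f hf hfc => ?_
  have hf' : ContDiff ℝ ((⊤ : ℕ∞) : WithTop ℕ∞) (fun x => (f x : ℂ)) :=
    Complex.ofRealCLM.contDiff.comp hf
  have hfc' : HasCompactSupport (fun x => (f x : ℂ)) :=
    hfc.comp_left (g := fun t : ℝ => (t : ℂ)) Complex.ofReal_zero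
  let φ : 𝓢(ℝ, ℂ) := hfc'.toSchwartzMap hf'
  have hφ : ∀ x, φ x = f x := fun x => rfl
  have key := congrArg (fun D => D φ) (MeasureTheory.Lp.fourier_toTemperedDistribution_eq (h2.toLp g))
  simp only [TemperedDistribution.fourier_apply, Lp.toTemperedDistribution_apply, hφ,
    Complex.coe_smul] at key
  rw [← key]
  have := VectorFourier.integral_fourierIntegral_smul_eq_flip (μ := volume) (ν := volume)
    (L := innerₗ ℝ) Real.continuous_fourierChar (by exact continuous_inner) φ.integrable h1
  calc ∫ x, (𝓕 φ) x • (h2.toLp g) x = ∫ x, (𝓕 φ) x • g x := by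
        refine integral_congr_ae ?_
        filter_upwards [h2.coeFn_toLp] with x hx
        rw [hx]
    _ = ∫ x, φ x • 𝓕 g x := by
        rw [fourier_coe]
        rw [flip_innerₗ] at this
        exact this
    _ = _ := by simp [hφ]

theorem lintegral_enorm_fourier_sq {g : ℝ → A} (h1 : Integrable g) (h2 : MemLp g 2) :
    ∫⁻ w, ‖𝓕 g w‖ₑ ^ 2 = ∫⁻ q, ‖g q‖ₑ ^ 2 := by
  have hL : ∀ F : Lp A 2 (volume : Measure ℝ), ∫⁻ q, ‖F q‖ₑ ^ 2 = ‖F‖ₑ ^ 2 := fun F => by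
    rw [Lp.enorm_def, eLpNorm_eq_lintegral_rpow_enorm_toReal (by norm_num) (by norm_num)]
    simp only [ENNReal.toReal_ofNat, ← ENNReal.rpow_natCast, ← ENNReal.rpow_mul]
    norm_num
  calc ∫⁻ w, ‖𝓕 g w‖ₑ ^ 2 = ∫⁻ w, ‖(𝓕 (h2.toLp g) : Lp A 2 (volume : Measure ℝ)) w‖ₑ ^ 2 := by
        refine lintegral_congr_ae ?_
        filter_upwards [coeFn_fourier_toLp h1 h2] with w hw
        rw [hw]
    _ = ∫⁻ q, ‖h2.toLp g q‖ₑ ^ 2 := by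
        rw [hL, hL, ← ofReal_norm, ← ofReal_norm, Lp.norm_fourier_eq]
    _ = _ := by
        refine lintegral_congr_ae ?_
        filter_upwards [h2.coeFn_toLp] with x hx
        rw [hx]

/-- The substitution y = 2πw from the unitary normalisation of the Fourier transform produces the
factor 2π. -/
theorem lintegral_enorm_integral_exp_sq {g : ℝ → A} (h1 : Integrable g) (h2 : MemLp g 2) :
    ∫⁻ y : ℝ, ‖∫ q : ℝ, Complex.exp (-(Complex.I * y * q)) • g q‖ₑ ^ 2 =
      ENNReal.ofReal (2 * Real.pi) * ∫⁻ q, ‖g q‖ₑ ^ 2 := by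
  have hpi := Real.pi_pos
  rw [← lintegral_enorm_fourier_sq h1 h2]
  have h : ∀ w : ℝ, 𝓕 g w =
      ∫ q : ℝ, Complex.exp (-(Complex.I * ((2 * Real.pi * w : ℝ) : ℂ) * q)) • g q := fun w => by
    rw [Real.fourier_real_eq_integral_exp_smul]
    refine integral_congr_ae (Eventually.of_forall fun q => ?_)
    simp only
    congr 2
    push_cast
    ring
  simp_rw [h]
  set G : ℝ → ℝ≥0∞ := fun y => ‖∫ q : ℝ, Complex.exp (-(Complex.I * y * q)) • g q‖ₑ ^ 2
  have := MeasureTheory.lintegral_map_equiv (μ := volume) G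
    (Homeomorph.mulLeft₀ (2 * Real.pi) (by positivity)).toMeasurableEquiv
  change _ = _ * ∫⁻ w, G (2 * Real.pi * w)
  simp only [Homeomorph.toMeasurableEquiv_coe, Homeomorph.coe_mulLeft₀] at this
  rw [← this, Real.map_volume_mul_left (by positivity), lintegral_smul_measure, smul_eq_mul,
    ← mul_assoc, ← ENNReal.ofReal_mul (by positivity), abs_of_pos (by positivity),
    mul_inv_cancel₀ (by positivity)]
  simp

end Plancherel

/-! ### Exchanging sums and integrals over possibly uncountable bases -/

section Countable

/-- The ancilla may be nonseparable, so a Hilbert basis may be uncountable, where monotone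
convergence for series does not apply. Countable support restores it. -/
theorem lintegral_tsum_of_countable {Z ι : Type*} [MeasurableSpace Z] {μ : Measure Z}
    {f : ι → Z → ℝ≥0∞} (hf : ∀ i, AEMeasurable (f i) μ) {s : Set ι} (hs : s.Countable)
    (h0 : ∀ i ∉ s, ∀ z, f i z = 0) : ∫⁻ z, ∑' i, f i z ∂μ = ∑' i, ∫⁻ z, f i z ∂μ := by
  have : Countable s := hs
  have h1 : ∀ z, ∑' i, f i z = ∑' i : s, f i z := fun z =>
    (tsum_subtype_eq_of_support_subset (f := fun i => f i z) fun i hi => by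
      by_contra h
      exact hi (h0 i h z)).symm
  have h2 : ∑' i, ∫⁻ z, f i z ∂μ = ∑' i : s, ∫⁻ z, f i z ∂μ :=
    (tsum_subtype_eq_of_support_subset (f := fun i => ∫⁻ z, f i z ∂μ) fun i hi => by
      by_contra h
      exact hi (by simp [h0 i h])).symm
  simp_rw [h1, h2]
  exact lintegral_tsum fun i => hf i

variable {H : Type*} [NormedAddCommGroup H] [InnerProductSpace ℂ H]

theorem countable_inner_ne_zero {ι : Type*} (b : HilbertBasis ι ℂ H) (x : H) :
    {i | inner ℂ (b i) x ≠ 0}.Countable := by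
  have h := (ENNReal.summable (f := fun i => ‖inner ℂ (b i) x‖ₑ ^ 2))
  have h2 : ∑' i, ‖inner ℂ (b i) x‖ₑ ^ 2 ≠ ∞ := by
    rw [← enorm_sq_eq_tsum]; simp
  refine (Summable.countable_support_ennreal h2).mono fun i hi => ?_
  simpa using hi

/-- Each vector has countably many nonzero coefficients. By continuity, a coefficient vanishing on a
countable dense set of z vanishes for every z. -/
theorem countable_exists_inner_ne_zero {ι Z : Type*} [TopologicalSpace Z]
    [TopologicalSpace.SeparableSpace Z] (b : HilbertBasis ι ℂ H) {h : Z → H} (hh : Continuous h) :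
    {i | ∃ z, inner ℂ (b i) (h z) ≠ 0}.Countable := by
  obtain ⟨D, hDc, hD⟩ := TopologicalSpace.exists_countable_dense Z
  refine (hDc.biUnion fun z _ => countable_inner_ne_zero b (h z)).mono ?_
  rintro i ⟨z, hz⟩
  by_contra hcon
  simp only [Set.mem_iUnion, Set.mem_ofPred_eq, not_exists, not_not] at hcon
  have hc : Continuous fun z => (inner ℂ (b i) (h z) : ℂ) := continuous_const.inner hh
  refine hz (congrFun (Continuous.ext_on hD hc continuous_const fun w hw => hcon w hw) z)

theorem lintegral_enorm_sq_eq_tsum {ι Z : Type*} [TopologicalSpace Z]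
    [TopologicalSpace.SeparableSpace Z] [MeasurableSpace Z] [OpensMeasurableSpace Z]
    {μ : Measure Z} (b : HilbertBasis ι ℂ H) {h : Z → H} (hh : Continuous h) :
    ∫⁻ z, ‖h z‖ₑ ^ 2 ∂μ = ∑' i, ∫⁻ z, ‖inner ℂ (b i) (h z)‖ₑ ^ 2 ∂μ := by
  simp_rw [fun z => enorm_sq_eq_tsum b (h z)]
  refine lintegral_tsum_of_countable (fun i => ?_) (countable_exists_inner_ne_zero b hh) ?_
  · have hc : Continuous fun z => (inner ℂ (b i) (h z) : ℂ) := continuous_const.inner hh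
    exact (hc.enorm.measurable.pow_const 2).aemeasurable
  · intro i hi z
    simp only [Set.mem_ofPred_eq, not_exists, not_not] at hi
    simp [hi z]

end Countable

end BK

namespace BK

/-! ### Continuous families of Kraus operators -/

section KrausFamily

variable {H Z : Type*} [NormedAddCommGroup H] [InnerProductSpace ℂ H] [CompleteSpace H]
  {K : Z → H →L[ℂ] H} {ρ : H →L[ℂ] H}

theorem kraus_conj_eq (hρ : ρ.IsPositive) (K : H →L[ℂ] H) :
    K.comp (ρ.comp (ContinuousLinearMap.adjoint K)) =
      (K * CFC.sqrt ρ) * star (K * CFC.sqrt ρ) := by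
  rw [star_mul, (isSelfAdjoint_sqrt ρ).star_eq, ContinuousLinearMap.star_eq_adjoint]
  conv_lhs => rw [← sqrt_comp_sqrt hρ]
  simp only [← ContinuousLinearMap.mul_def, mul_assoc]

theorem hsSq_sqrt_of_isState (hρ : IsState ρ) : hsSq (CFC.sqrt ρ) = 1 := by
  rw [← posTrace_eq_hsSq hρ.1, hρ.2]

theorem inner_kraus_conj (hρ : ρ.IsPositive) (K : H →L[ℂ] H) (x : H) :
    inner ℂ x (K.comp (ρ.comp (ContinuousLinearMap.adjoint K)) x) =
      ((‖ContinuousLinearMap.adjoint (K * CFC.sqrt ρ) x‖ ^ 2 : ℝ) : ℂ) := by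
  rw [kraus_conj_eq hρ, ContinuousLinearMap.mul_def, ContinuousLinearMap.comp_apply,
    ContinuousLinearMap.star_eq_adjoint, ← ContinuousLinearMap.adjoint_inner_left,
    inner_self_eq_norm_sq_to_K]
  norm_cast

theorem inner_kraus_conj_pureOp (K : H →L[ℂ] H) (φ ψ : H) :
    inner ℂ φ (K.comp ((pureOp ψ).comp (ContinuousLinearMap.adjoint K)) φ) =
      ((‖inner ℂ φ (K ψ)‖ ^ 2 : ℝ) : ℂ) := by
  simp only [ContinuousLinearMap.comp_apply, pureOp_apply, map_smul, inner_smul_right,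
    ContinuousLinearMap.adjoint_inner_right]
  rw [← inner_conj_symm (K ψ) φ, mul_comm, Complex.mul_conj, Complex.normSq_eq_norm_sq]

theorem continuous_kraus_conj [TopologicalSpace Z] (hK : Continuous K) (ρ : H →L[ℂ] H) :
    Continuous fun z => (K z).comp (ρ.comp (ContinuousLinearMap.adjoint (K z))) :=
  hK.clm_comp (continuous_const.clm_comp (ContinuousLinearMap.adjoint.continuous.comp hK))

variable [MeasurableSpace Z] {μ : Measure Z}

theorem inner_integral_kraus_conj
    (hint : Integrable (fun z => (K z).comp (ρ.comp (ContinuousLinearMap.adjoint (K z)))) μ)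
    (x : H) : inner ℂ x ((∫ z, (K z).comp (ρ.comp (ContinuousLinearMap.adjoint (K z))) ∂μ) x) =
      ∫ z, inner ℂ x ((K z).comp (ρ.comp (ContinuousLinearMap.adjoint (K z))) x) ∂μ := by
  rw [ContinuousLinearMap.integral_apply hint, ← integral_inner]
  exact hint.apply_continuousLinearMap x

theorem inner_integral_kraus_conj_eq_ofReal (hρ : ρ.IsPositive)
    (hint : Integrable (fun z => (K z).comp (ρ.comp (ContinuousLinearMap.adjoint (K z)))) μ)
    (x : H) : inner ℂ x ((∫ z, (K z).comp (ρ.comp (ContinuousLinearMap.adjoint (K z))) ∂μ) x) =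
      ((∫ z, ‖ContinuousLinearMap.adjoint (K z * CFC.sqrt ρ) x‖ ^ 2 ∂μ : ℝ) : ℂ) := by
  rw [inner_integral_kraus_conj hint, ← integral_complex_ofReal]
  exact integral_congr_ae (Eventually.of_forall fun z => inner_kraus_conj hρ (K z) x)

variable [TopologicalSpace Z]

variable [BorelSpace Z]

/-- Apply the isometry identity to each S e_i. Finiteness of the Hilbert–Schmidt norm leaves only
countably many nonzero S e_i, which permits the exchange. -/
theorem lintegral_hsSq_mul (hK : Continuous K) (hiso : ∀ f, ∫⁻ z, ‖K z f‖ₑ ^ 2 ∂μ = ‖f‖ₑ ^ 2)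
    {S : H →L[ℂ] H} (hS : hsSq S ≠ ∞) : ∫⁻ z, hsSq (K z * S) ∂μ = hsSq S := by
  unfold hsSq at *
  rw [lintegral_tsum_of_countable (s := {i | S (traceBasis H i) ≠ 0})]
  · exact tsum_congr fun i => hiso _
  · intro i
    have hc : Continuous fun z => K z (S (traceBasis H i)) := hK.clm_apply continuous_const
    exact (hc.enorm.measurable.pow_const 2).aemeasurable
  · refine (Summable.countable_support_ennreal hS).mono fun i hi => ?_
    simpa using hi
  · intro i hi z
    simp only [Set.mem_ofPred_eq, not_not] at hi
    rw [ContinuousLinearMap.mul_def, ContinuousLinearMap.comp_apply, hi, map_zero]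
    simp

variable [SecondCountableTopology Z]

/-- The operator norm of (K√ρ)(K√ρ)* is ‖K√ρ‖², which is at most the squared Hilbert–Schmidt norm;
the latter integrates to Tr ρ = 1. -/
theorem integrable_kraus_conj (hK : Continuous K)
    (hiso : ∀ f, ∫⁻ z, ‖K z f‖ₑ ^ 2 ∂μ = ‖f‖ₑ ^ 2) (hρ : IsState ρ) :
    Integrable (fun z => (K z).comp (ρ.comp (ContinuousLinearMap.adjoint (K z)))) μ := by
  refine ⟨(continuous_kraus_conj hK ρ).aestronglyMeasurable, ?_⟩
  have h1 := hsSq_sqrt_of_isState hρ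
  have h2 := lintegral_hsSq_mul hK hiso (S := CFC.sqrt ρ) (by simp [h1])
  refine lt_of_le_of_lt (lintegral_mono fun z => ?_) (by rw [h2, h1]; simp)
  simp only
  rw [kraus_conj_eq hρ.1]
  refine le_trans (le_of_eq ?_) (opNorm_enorm_sq_le_hsSq _)
  rw [← ofReal_norm, CStarRing.norm_self_mul_star, ENNReal.ofReal_mul (norm_nonneg _), ofReal_norm,
    sq]

/-- A norm-continuous family of Kraus operators with `∫ K_z† K_z = 1` maps states to states. -/
theorem isState_integral_kraus_conj (hK : Continuous K)
    (hiso : ∀ f, ∫⁻ z, ‖K z f‖ₑ ^ 2 ∂μ = ‖f‖ₑ ^ 2) (hρ : IsState ρ) :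
    IsState (∫ z, (K z).comp (ρ.comp (ContinuousLinearMap.adjoint (K z))) ∂μ) := by
  have hint := integrable_kraus_conj hK hiso hρ
  set Φ := ∫ z, (K z).comp (ρ.comp (ContinuousLinearMap.adjoint (K z))) ∂μ with hΦ
  have hin := inner_integral_kraus_conj_eq_ofReal hρ.1 hint
  rw [← hΦ] at hin
  have hcS : Continuous fun z => K z * CFC.sqrt ρ := hK.mul continuous_const
  have hca : ∀ x, Continuous fun z => ContinuousLinearMap.adjoint (K z * CFC.sqrt ρ) x := fun x =>
    (ContinuousLinearMap.adjoint.continuous.comp hcS).clm_apply continuous_const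
  refine ⟨?_, ?_⟩
  · rw [ContinuousLinearMap.isPositive_iff_complex]
    intro x
    have h : inner ℂ (Φ x) x =
        ((∫ z, ‖ContinuousLinearMap.adjoint (K z * CFC.sqrt ρ) x‖ ^ 2 ∂μ : ℝ) : ℂ) := by
      rw [← inner_conj_symm, hin, Complex.conj_ofReal]
    rw [h]
    refine ⟨by simp, ?_⟩
    simpa using integral_nonneg fun z => by positivity
  · rw [posTrace_eq_tsum]
    -- The adjoints (K_z √ρ)† e_i are expanded in the basis so that, after swapping i and j, the sum
    -- over i rebuilds ‖K_z √ρ e_j‖², to which the isometry identity applies.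
    calc ∑' i, ENNReal.ofReal (inner ℂ (traceBasis H i) (Φ (traceBasis H i))).re
        = ∑' i, ∫⁻ z, ‖ContinuousLinearMap.adjoint (K z * CFC.sqrt ρ) (traceBasis H i)‖ₑ ^ 2 ∂μ := by
          refine tsum_congr fun i => ?_
          rw [hin, Complex.ofReal_re, ofReal_integral_eq_lintegral_ofReal]
          · exact lintegral_congr fun z => ofReal_norm_sq _
          · have := ((hint.apply_continuousLinearMap (traceBasis H i)).const_inner
              (𝕜 := ℂ) (traceBasis H i)).re
            refine this.congr (Eventually.of_forall fun z => ?_)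
            simp only
            rw [inner_kraus_conj hρ.1]
            exact Complex.ofReal_re _
          · exact Eventually.of_forall fun z => by positivity
      _ = ∑' i, ∑' j, ∫⁻ z,
            ‖inner ℂ (traceBasis H i) ((K z * CFC.sqrt ρ) (traceBasis H j))‖ₑ ^ 2 ∂μ := by
          refine tsum_congr fun i => ?_
          rw [lintegral_enorm_sq_eq_tsum (traceBasis H) (hca _)]
          refine tsum_congr fun j => lintegral_congr fun z => ?_
          rw [ContinuousLinearMap.adjoint_inner_right, ← inner_conj_symm, ← ofReal_norm,
            RCLike.norm_conj, ofReal_norm]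
      _ = ∑' j, ∫⁻ z, ‖(K z * CFC.sqrt ρ) (traceBasis H j)‖ₑ ^ 2 ∂μ := by
          rw [ENNReal.tsum_comm]
          exact tsum_congr fun j => (lintegral_enorm_sq_eq_tsum (traceBasis H)
            (hcS.clm_apply continuous_const)).symm
      _ = ∑' j, ‖CFC.sqrt ρ (traceBasis H j)‖ₑ ^ 2 := tsum_congr fun j => hiso _
      _ = 1 := hsSq_sqrt_of_isState hρ

theorem inner_integral_kraus_conj_pureOp (hK : Continuous K)
    (hiso : ∀ f, ∫⁻ z, ‖K z f‖ₑ ^ 2 ∂μ = ‖f‖ₑ ^ 2) {ψ : H} (hψ : ‖ψ‖ = 1) (φ : H) :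
    inner ℂ φ ((∫ z, (K z).comp ((pureOp ψ).comp (ContinuousLinearMap.adjoint (K z))) ∂μ) φ) =
      ((∫ z, ‖inner ℂ φ (K z ψ)‖ ^ 2 ∂μ : ℝ) : ℂ) := by
  rw [inner_integral_kraus_conj (integrable_kraus_conj hK hiso (isState_pureOp hψ)),
    ← integral_complex_ofReal]
  exact integral_congr_ae (Eventually.of_forall fun z => inner_kraus_conj_pureOp (K z) φ ψ)

end KrausFamily

end BK

namespace BK

/-! ### Real Gaussian integrals -/

section Gaussian

theorem integrable_exp_quadratic {a : ℝ} (ha : 0 < a) (b c : ℝ) :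
    Integrable fun x : ℝ => Real.exp (-a * x ^ 2 + b * x + c) := by
  have h : ∀ x : ℝ, Real.exp (-a * x ^ 2 + b * x + c) =
      Real.exp (-a * (x - b / (2 * a)) ^ 2) * Real.exp (c + b ^ 2 / (4 * a)) := fun x => by
    rw [← Real.exp_add]
    congr 1
    field_simp
    ring
  simp_rw [h]
  exact ((integrable_exp_neg_mul_sq ha).comp_sub_right _).mul_const _

theorem integral_exp_quadratic {a : ℝ} (ha : 0 < a) (b c : ℝ) :
    ∫ x : ℝ, Real.exp (-a * x ^ 2 + b * x + c) =
      √(Real.pi / a) * Real.exp (c + b ^ 2 / (4 * a)) := by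
  have h : ∀ x : ℝ, Real.exp (-a * x ^ 2 + b * x + c) =
      Real.exp (-a * (x - b / (2 * a)) ^ 2) * Real.exp (c + b ^ 2 / (4 * a)) := fun x => by
    rw [← Real.exp_add]
    congr 1
    field_simp
    ring
  simp_rw [h]
  rw [integral_mul_const,
    integral_sub_right_eq_self (fun x : ℝ => Real.exp (-a * x ^ 2)) (b / (2 * a)),
    integral_gaussian]

end Gaussian

/-! ### The TMSV wave function and its marginal -/

section Wave

variable {μ : ℝ}

theorem sq_sqrt_sub (hμ : 1 / 2 ≤ μ) : √(μ ^ 2 - 1 / 4) ^ 2 = μ ^ 2 - 1 / 4 :=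
  Real.sq_sqrt (by nlinarith)

theorem sqrt_sub_lt (hμ : 1 / 2 ≤ μ) : √(μ ^ 2 - 1 / 4) < μ := by
  rw [Real.sqrt_lt' (by linarith)]
  linarith

/-- The real-valued TMSV wave function. -/
noncomputable def tmsvAmp (μ q₁ q₂ : ℝ) : ℝ :=
  (√Real.pi)⁻¹ * Real.exp (-μ * (q₁ ^ 2 + q₂ ^ 2) + 2 * √(μ ^ 2 - 1 / 4) * q₁ * q₂)

theorem tmsvWave_eq (μ a b : ℝ) : tmsvWave μ a b = (tmsvAmp μ a b : ℂ) := rfl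

theorem tmsvAmp_nonneg (μ a b : ℝ) : 0 ≤ tmsvAmp μ a b := by
  unfold tmsvAmp; positivity

theorem norm_tmsvWave (μ a b : ℝ) : ‖tmsvWave μ a b‖ = tmsvAmp μ a b := by
  rw [tmsvWave_eq, Complex.norm_real, Real.norm_of_nonneg (tmsvAmp_nonneg _ _ _)]

theorem continuous_tmsvAmp (μ : ℝ) : Continuous fun p : ℝ × ℝ => tmsvAmp μ p.1 p.2 := by
  unfold tmsvAmp; fun_prop

theorem continuous_tmsvWave (μ : ℝ) : Continuous fun p : ℝ × ℝ => tmsvWave μ p.1 p.2 :=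
  Complex.continuous_ofReal.comp (continuous_tmsvAmp μ)

theorem tmsvAmp_comm (μ a b : ℝ) : tmsvAmp μ a b = tmsvAmp μ b a := by
  unfold tmsvAmp; ring_nf

/-- From 2ab ≤ a² + b²: the correlated Gaussian lies below a product of Gaussians of rate μ - √(μ² -
1/4) > 0, the source of all the dominating functions. -/
theorem tmsvAmp_le (μ a b : ℝ) : tmsvAmp μ a b ≤
    (√Real.pi)⁻¹ * (Real.exp (-(μ - √(μ ^ 2 - 1 / 4)) * a ^ 2) *
      Real.exp (-(μ - √(μ ^ 2 - 1 / 4)) * b ^ 2)) := by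
  unfold tmsvAmp
  rw [← Real.exp_add]
  refine mul_le_mul_of_nonneg_left (Real.exp_le_exp.2 ?_) (by positivity)
  nlinarith [mul_nonneg (Real.sqrt_nonneg (μ ^ 2 - 1 / 4)) (sq_nonneg (a - b))]

theorem tmsvAmp_mul (μ b q s : ℝ) : tmsvAmp μ s b * tmsvAmp μ s q =
    Real.pi⁻¹ * Real.exp (-(2 * μ) * s ^ 2 + 2 * √(μ ^ 2 - 1 / 4) * (b + q) * s +
      -μ * (b ^ 2 + q ^ 2)) := by
  unfold tmsvAmp
  have h : (√Real.pi)⁻¹ * (√Real.pi)⁻¹ = Real.pi⁻¹ := by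
    rw [← mul_inv, Real.mul_self_sqrt Real.pi_nonneg]
  rw [mul_mul_mul_comm, h, ← Real.exp_add]
  ring_nf

theorem integrable_tmsvAmp_mul (hμ : 1 / 2 ≤ μ) (b q : ℝ) :
    Integrable fun s => tmsvAmp μ s b * tmsvAmp μ s q := by
  simp_rw [tmsvAmp_mul μ]
  exact (integrable_exp_quadratic (by linarith) _ _).const_mul _

/-- The integral kernel of the reduced state of one of the two modes. -/
theorem integral_tmsvAmp_mul (hμ : 1 / 2 ≤ μ) (b q : ℝ) :
    ∫ s, tmsvAmp μ s b * tmsvAmp μ s q = (√(2 * Real.pi * μ))⁻¹ *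
      (Real.exp (-(1 / (8 * μ)) * (b + q) ^ 2) * Real.exp (-(μ / 2) * (b - q) ^ 2)) := by
  have hμ0 : 0 < μ := by linarith
  have hpi := Real.pi_pos
  simp_rw [tmsvAmp_mul μ]
  rw [integral_const_mul, integral_exp_quadratic (by linarith), ← mul_assoc]
  congr 1
  · rw [Real.sqrt_div hpi.le, Real.sqrt_mul (by positivity), Real.sqrt_mul (by positivity),
      Real.sqrt_mul (by positivity)]
    nth_rewrite 1 [← Real.mul_self_sqrt hpi.le]
    field_simp
  · rw [← Real.exp_add]
    congr 1
    have h : (2 * √(μ ^ 2 - 1 / 4) * (b + q)) ^ 2 = 4 * (μ ^ 2 - 1 / 4) * (b + q) ^ 2 := by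
      rw [mul_pow, mul_pow, sq_sqrt_sub hμ]; ring
    rw [h]
    field_simp
    ring

theorem lintegral_ofReal_tmsvAmp_sq (hμ : 1 / 2 ≤ μ) (b : ℝ) :
    ∫⁻ s, ENNReal.ofReal (tmsvAmp μ s b ^ 2) =
      ENNReal.ofReal ((√(2 * Real.pi * μ))⁻¹ * Real.exp (-(1 / (2 * μ)) * b ^ 2)) := by
  have hμ0 : 0 < μ := by linarith
  simp_rw [sq (tmsvAmp μ _ b)]
  rw [← ofReal_integral_eq_lintegral_ofReal (integrable_tmsvAmp_mul hμ b b)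
    (Eventually.of_forall fun s => mul_self_nonneg _), integral_tmsvAmp_mul hμ]
  congr 2
  rw [← Real.exp_add]
  congr 1
  field_simp
  ring

theorem lintegral_tmsv_marginal (hμ : 1 / 2 ≤ μ) :
    ∫⁻ b, ENNReal.ofReal ((√(2 * Real.pi * μ))⁻¹ * Real.exp (-(1 / (2 * μ)) * b ^ 2)) = 1 := by
  have hμ0 : 0 < μ := by linarith
  have hpi := Real.pi_pos
  rw [← ofReal_integral_eq_lintegral_ofReal
    ((integrable_exp_neg_mul_sq (by positivity)).const_mul _)
    (Eventually.of_forall fun s => by positivity), integral_const_mul, integral_gaussian]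
  have : Real.pi / (1 / (2 * μ)) = 2 * Real.pi * μ := by field_simp
  rw [this, inv_mul_cancel₀ (by positivity), ENNReal.ofReal_one]

end Wave

/-! ### Dominated convergence in L² -/

section DominatedL2

theorem eLpNorm_two_sq {Ω E : Type*} [MeasurableSpace Ω] {μ : Measure Ω} [NormedAddCommGroup E]
    (f : Ω → E) : eLpNorm f 2 μ ^ 2 = ∫⁻ ω, ‖f ω‖ₑ ^ 2 ∂μ := by
  rw [eLpNorm_eq_lintegral_rpow_enorm_toReal (by norm_num) (by norm_num)]
  simp only [ENNReal.toReal_ofNat, ← ENNReal.rpow_natCast, ← ENNReal.rpow_mul]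
  norm_num

theorem tendsto_eLpNorm_sub_of_dominated {X Ω E : Type*} [TopologicalSpace X]
    [FirstCountableTopology X] [MeasurableSpace Ω] {μ : Measure Ω} [NormedAddCommGroup E]
    {F : X → Ω → E} {x₀ : X} {g : Ω → ℝ} (hm : ∀ x, AEStronglyMeasurable (F x) μ)
    (hc : ∀ ω, ContinuousAt (fun x => F x ω) x₀) (hg : MemLp g 2 μ)
    (hb : ∀ᶠ x in 𝓝 x₀, ∀ ω, ‖F x ω‖ ≤ g ω) :
    Tendsto (fun x => eLpNorm (F x - F x₀) 2 μ) (𝓝 x₀) (𝓝 0) := by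
  have h : Tendsto (fun x => ∫⁻ ω, ‖(F x - F x₀) ω‖ₑ ^ 2 ∂μ) (𝓝 x₀) (𝓝 (∫⁻ _, 0 ∂μ)) := by
    refine tendsto_lintegral_filter_of_dominated_convergence' (fun ω => ‖(2 * g ω)‖ₑ ^ 2)
      (Eventually.of_forall fun x => (((hm x).sub (hm x₀)).enorm.pow_const 2)) ?_ ?_ ?_
    · filter_upwards [hb] with x hx
      refine Eventually.of_forall fun ω => ?_
      rw [← ofReal_norm_sq, ← ofReal_norm_sq]
      gcongr
      rw [Pi.sub_apply, two_mul]
      refine (norm_sub_le _ _).trans ((add_le_add (hx ω) (hb.self_of_nhds ω)).trans ?_)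
      exact le_abs_self _
    · rw [← eLpNorm_two_sq]
      exact (ENNReal.pow_lt_top (hg.const_mul 2).2).ne
    · refine Eventually.of_forall fun ω => ?_
      have h1 : Tendsto (fun x => (F x - F x₀) ω) (𝓝 x₀) (𝓝 0) := by
        simpa using (hc ω).tendsto.sub_const (F x₀ ω)
      simpa using ENNReal.Tendsto.pow (n := 2) ((continuous_enorm.tendsto _).comp h1)
  simp only [lintegral_zero, ← eLpNorm_two_sq] at h
  have h2 := (ENNReal.continuous_rpow_const (y := (1 / 2 : ℝ))).tendsto 0 |>.comp h
  have h3 : (fun x : ℝ≥0∞ => x ^ (1 / 2 : ℝ)) ∘ (fun x => eLpNorm (F x - F x₀) 2 μ ^ 2) =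
      fun x => eLpNorm (F x - F x₀) 2 μ := by
    funext x
    simp only [Function.comp_apply, ← ENNReal.rpow_natCast, ← ENNReal.rpow_mul]
    norm_num
  rw [h3] at h2
  simpa using h2

end DominatedL2

/-! ### The TMSV state as a unit vector -/

section TmsvVector

variable {μ : ℝ}

theorem memLp_exp_neg_mul_sq {a : ℝ} (ha : 0 < a) :
    MemLp (fun x : ℝ => Real.exp (-a * x ^ 2)) 2 := by
  rw [memLp_two_iff_integrable_sq (by fun_prop)]
  have h : ∀ x : ℝ, Real.exp (-a * x ^ 2) ^ 2 = Real.exp (-(2 * a) * x ^ 2) := fun x => by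
    rw [← Real.exp_nat_mul]; congr 1; push_cast; ring
  simp_rw [h]
  exact integrable_exp_neg_mul_sq (by positivity)

/-- The wave function of the first mode, for a fixed position of the second. -/
theorem continuous_tmsvWave_left (μ q : ℝ) : Continuous fun s => tmsvWave μ s q :=
  (continuous_tmsvWave μ).comp (continuous_id.prodMk continuous_const)

theorem memLp_tmsv_bound (hμ : 1 / 2 ≤ μ) :
    MemLp (fun s : ℝ => (√Real.pi)⁻¹ * Real.exp (-(μ - √(μ ^ 2 - 1 / 4)) * s ^ 2)) 2 :=
  (memLp_exp_neg_mul_sq (sub_pos.2 (sqrt_sub_lt hμ))).const_mul _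

theorem norm_tmsvWave_le (hμ : 1 / 2 ≤ μ) (s q : ℝ) : ‖tmsvWave μ s q‖ ≤
    (√Real.pi)⁻¹ * Real.exp (-(μ - √(μ ^ 2 - 1 / 4)) * s ^ 2) := by
  rw [norm_tmsvWave]
  refine (tmsvAmp_le μ s q).trans ?_
  gcongr
  refine mul_le_of_le_one_right (Real.exp_nonneg _) (Real.exp_le_one_iff.2 ?_)
  nlinarith [sq_nonneg q, sqrt_sub_lt hμ]

theorem memLp_tmsvWave (hμ : 1 / 2 ≤ μ) (q : ℝ) : MemLp (fun s => tmsvWave μ s q) 2 :=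
  (memLp_tmsv_bound hμ).mono' (continuous_tmsvWave_left μ q).aestronglyMeasurable
    (Eventually.of_forall fun s => norm_tmsvWave_le hμ s q)

/-- The conditional state of the first mode, as a function of the position of the second. -/
noncomputable def tmsvSlice (μ q : ℝ) : Mode := toL2 fun s => tmsvWave μ s q

theorem tmsvSlice_eq (hμ : 1 / 2 ≤ μ) (q : ℝ) : tmsvSlice μ q = (memLp_tmsvWave hμ q).toLp _ :=
  dif_pos _

/-- Continuity supplies the strong measurability required of an L²-valued function of q. -/
theorem continuous_tmsvSlice (hμ : 1 / 2 ≤ μ) : Continuous (tmsvSlice μ) := by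
  refine continuous_iff_continuousAt.2 fun q => ?_
  rw [ContinuousAt, tendsto_iff_edist_tendsto_0]
  have := tendsto_eLpNorm_sub_of_dominated (F := fun q s => tmsvWave μ s q) (x₀ := q)
    (fun q => (continuous_tmsvWave_left μ q).aestronglyMeasurable)
    (fun s => ((continuous_tmsvWave μ).comp
      (continuous_const.prodMk continuous_id)).continuousAt)
    (memLp_tmsv_bound hμ) (Eventually.of_forall fun q s => norm_tmsvWave_le hμ s q)
  refine this.congr fun p => ?_
  rw [tmsvSlice_eq hμ, tmsvSlice_eq hμ, Lp.edist_toLp_toLp]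

theorem inner_tmsvSlice (hμ : 1 / 2 ≤ μ) (b q : ℝ) :
    inner ℂ (tmsvSlice μ b) (tmsvSlice μ q) = (((√(2 * Real.pi * μ))⁻¹ *
      (Real.exp (-(1 / (8 * μ)) * (b + q) ^ 2) * Real.exp (-(μ / 2) * (b - q) ^ 2)) : ℝ) : ℂ) := by
  rw [← integral_tmsvAmp_mul hμ, ← integral_complex_ofReal, tmsvSlice_eq hμ, tmsvSlice_eq hμ,
    L2.inner_def]
  refine integral_congr_ae ?_
  filter_upwards [(memLp_tmsvWave hμ b).coeFn_toLp, (memLp_tmsvWave hμ q).coeFn_toLp] with s h1 h2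
  rw [h1, h2]
  simp only [tmsvWave_eq, RCLike.inner_apply, Complex.conj_ofReal]
  push_cast
  ring

theorem enorm_tmsvSlice_sq (hμ : 1 / 2 ≤ μ) (q : ℝ) : ‖tmsvSlice μ q‖ₑ ^ 2 =
    ENNReal.ofReal ((√(2 * Real.pi * μ))⁻¹ * Real.exp (-(1 / (2 * μ)) * q ^ 2)) := by
  rw [← lintegral_ofReal_tmsvAmp_sq hμ, tmsvSlice_eq hμ, Lp.enorm_toLp, eLpNorm_two_sq]
  refine lintegral_congr fun s => ?_
  rw [← ofReal_norm_sq, norm_tmsvWave]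

theorem eLpNorm_tmsvSlice_sq (hμ : 1 / 2 ≤ μ) : eLpNorm (tmsvSlice μ) 2 volume ^ 2 = 1 := by
  rw [eLpNorm_two_sq]
  simp_rw [enorm_tmsvSlice_sq hμ]
  exact lintegral_tmsv_marginal hμ

theorem memLp_tmsvSlice (hμ : 1 / 2 ≤ μ) : MemLp (tmsvSlice μ) 2 := by
  refine ⟨(continuous_tmsvSlice hμ).aestronglyMeasurable, ?_⟩
  by_contra h
  have := eLpNorm_tmsvSlice_sq hμ
  rw [not_lt_top_iff.1 h] at this
  simp at this

theorem tmsvVec_eq (hμ : 1 / 2 ≤ μ) : tmsvVec μ = (memLp_tmsvSlice hμ).toLp _ :=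
  dif_pos (memLp_tmsvSlice hμ)

theorem norm_tmsvVec (hμ : 1 / 2 ≤ μ) : ‖tmsvVec μ‖ = 1 := by
  have h : ‖tmsvVec μ‖ₑ ^ 2 = 1 := by
    rw [tmsvVec_eq hμ, Lp.enorm_toLp, eLpNorm_tmsvSlice_sq hμ]
  rw [← ofReal_norm_sq, ENNReal.ofReal_eq_one] at h
  nlinarith [norm_nonneg (tmsvVec μ)]

theorem isState_tmsv (hμ : 1 / 2 ≤ μ) : IsState (tmsv μ) := isState_pureOp (norm_tmsvVec hμ)

end TmsvVector

end BK

namespace BK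

/-! ### Operators with square-integrable kernels -/

section KernelOperators

variable {A : Type*} [NormedAddCommGroup A] [InnerProductSpace ℂ A]

theorem coeFn_kernelOp {k : ℝ → ℝ → ℂ} (hk : MemLp (Function.uncurry k) 2 (volume.prod volume))
    (f : Joint A) : kernelOp A k f =ᵐ[volume] fun b => ∫ q, k b q • f q := by
  rw [kernelOp, dif_pos hk]
  exact MemLp.coeFn_toLp (memLp_kernel hk f)

/-- Reduces norm continuity of the Kraus operators to L² continuity of their kernels. -/
theorem norm_kernelOp_sub_le {k k' : ℝ → ℝ → ℂ}
    (hk : MemLp (Function.uncurry k) 2 (volume.prod volume))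
    (hk' : MemLp (Function.uncurry k') 2 (volume.prod volume)) :
    ‖kernelOp A k - kernelOp A k'‖ ≤
      (eLpNorm (Function.uncurry k - Function.uncurry k') 2 (volume.prod volume)).toReal := by
  have hd : MemLp (Function.uncurry (fun b q => k b q - k' b q)) 2 (volume.prod volume) :=
    hk.sub hk'
  refine ContinuousLinearMap.opNorm_le_bound _ ENNReal.toReal_nonneg fun f => ?_
  have h : (kernelOp A k - kernelOp A k') f = kernelOp A (fun b q => k b q - k' b q) f := by
    rw [sub_apply]
    refine Lp.ext ?_
    filter_upwards [coeFn_kernelOp hk f, coeFn_kernelOp hk' f, coeFn_kernelOp hd f,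
      Lp.coeFn_sub (kernelOp A k f) (kernelOp A k' f), ae_integrable_kernel hk f,
      ae_integrable_kernel hk' f] with b h1 h2 h3 h4 h5 h6
    rw [h3, h4, Pi.sub_apply, h1, h2, ← integral_sub h5 h6]
    simp_rw [sub_smul]
  rw [h, Lp.norm_def, Lp.norm_def, ← ENNReal.toReal_mul]
  refine ENNReal.toReal_mono (ENNReal.mul_lt_top hd.2 (Lp.memLp f).2).ne ?_
  exact (eLpNorm_congr_ae (coeFn_kernelOp hd f)).trans_le (eLpNorm_kernel_le hd f)

theorem inner_kernelOp [CompleteSpace A] {k : ℝ → ℝ → ℂ}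
    (hk : MemLp (Function.uncurry k) 2 (volume.prod volume)) (f g : Joint A) :
    inner ℂ f (kernelOp A k g) = ∫ b, ∫ q, k b q * inner ℂ (f b) (g q) := by
  rw [L2.inner_def]
  refine integral_congr_ae ?_
  filter_upwards [coeFn_kernelOp hk g, ae_integrable_kernel hk g] with b h1 h2
  rw [h1, ← integral_inner h2]
  simp_rw [inner_smul_right]

end KernelOperators

/-! ### The Kraus operators of the teleportation protocol -/

section Kraus

variable {μ : ℝ}

/-- The integral kernel of the Kraus operator of the BK protocol with Bell outcome `z`. -/
noncomputable def krausKernel (μ : ℝ) (z : ℝ × ℝ) (b q : ℝ) : ℂ :=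
  displace z.1 z.2 (fun b' => bellKernel μ z.1 z.2 b' q) b

theorem krausOp_eq (A : Type*) [NormedAddCommGroup A] [InnerProductSpace ℂ A] (μ : ℝ)
    (z : ℝ × ℝ) : krausOp A μ z = kernelOp A (krausKernel μ z) := rfl

theorem krausKernel_eq (μ : ℝ) (z : ℝ × ℝ) (b q : ℝ) : krausKernel μ z b q =
    Complex.exp (Complex.I * (z.2 * b - z.1 * z.2 / 2)) * (((√(2 * Real.pi))⁻¹ : ℝ) : ℂ) *
      (Complex.exp (-(Complex.I * z.2 * q)) * tmsvWave μ (q - z.1) (b - z.1)) := by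
  simp only [krausKernel, displace, bellKernel]
  ring

theorem continuous_krausKernel (μ : ℝ) :
    Continuous fun p : (ℝ × ℝ) × (ℝ × ℝ) => krausKernel μ p.1 p.2.1 p.2.2 := by
  simp only [krausKernel_eq]
  have : Continuous fun p : (ℝ × ℝ) × (ℝ × ℝ) => tmsvWave μ (p.2.2 - p.1.1) (p.2.1 - p.1.1) :=
    (continuous_tmsvWave μ).comp (f := fun p : (ℝ × ℝ) × (ℝ × ℝ) =>
      (p.2.2 - p.1.1, p.2.1 - p.1.1)) (by fun_prop)
  fun_prop

theorem norm_krausKernel (μ : ℝ) (z : ℝ × ℝ) (b q : ℝ) :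
    ‖krausKernel μ z b q‖ = (√(2 * Real.pi))⁻¹ * tmsvAmp μ (q - z.1) (b - z.1) := by
  have h1 : ‖Complex.exp (Complex.I * (z.2 * b - z.1 * z.2 / 2))‖ = 1 := by
    rw [Complex.norm_exp]
    simp [Complex.mul_re]
  have h2 : ‖Complex.exp (-(Complex.I * z.2 * q))‖ = 1 := by
    rw [Complex.norm_exp]
    simp [Complex.mul_re]
  rw [krausKernel_eq, norm_mul, norm_mul, norm_mul, h1, h2, norm_tmsvWave, Complex.norm_real,
    Real.norm_of_nonneg (by positivity), one_mul, one_mul]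

/-- A square-integrable bound on the Kraus kernels with outcomes near `z₀`. -/
noncomputable def krausBound (μ x₀ : ℝ) (p : ℝ × ℝ) : ℝ :=
  (√(2 * Real.pi))⁻¹ * (√Real.pi)⁻¹ * Real.exp (2 * (μ - √(μ ^ 2 - 1 / 4))) *
    (Real.exp (-((μ - √(μ ^ 2 - 1 / 4)) / 2) * (p.1 - x₀) ^ 2) *
      Real.exp (-((μ - √(μ ^ 2 - 1 / 4)) / 2) * (p.2 - x₀) ^ 2))

theorem memLp_krausBound (hμ : 1 / 2 ≤ μ) (x₀ : ℝ) :
    MemLp (krausBound μ x₀) 2 (volume.prod volume) := by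
  unfold krausBound
  refine MemLp.const_mul ?_ _
  have hm : 0 < μ - √(μ ^ 2 - 1 / 4) := sub_pos.2 (sqrt_sub_lt hμ)
  have h1 := (memLp_two_iff_integrable_sq (by fun_prop)).1
    (memLp_exp_neg_mul_sq (a := (μ - √(μ ^ 2 - 1 / 4)) / 2) (by positivity))
  have h2 := h1.comp_sub_right x₀
  rw [memLp_two_iff_integrable_sq (by fun_prop)]
  simp_rw [mul_pow]
  exact h2.mul_prod h2

theorem norm_krausKernel_le (hμ : 1 / 2 ≤ μ) {x₀ : ℝ} {z : ℝ × ℝ} (hz : |z.1 - x₀| ≤ 1)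
    (p : ℝ × ℝ) : ‖krausKernel μ z p.1 p.2‖ ≤ krausBound μ x₀ p := by
  have hm : 0 < μ - √(μ ^ 2 - 1 / 4) := sub_pos.2 (sqrt_sub_lt hμ)
  rw [norm_krausKernel, krausBound, mul_assoc, mul_assoc]
  refine mul_le_mul_of_nonneg_left ((tmsvAmp_le _ _ _).trans ?_) (by positivity)
  refine mul_le_mul_of_nonneg_left ?_ (by positivity)
  rw [← Real.exp_add, ← Real.exp_add, ← Real.exp_add, Real.exp_le_exp]
  have hz2 : (z.1 - x₀) ^ 2 ≤ 1 := by
    rw [← sq_abs]; exact pow_le_one₀ (abs_nonneg _) hz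
  -- From (u + v)² ≤ 2u² + 2v² with |v| ≤ 1. This explains the halved rate in `krausBound`; the loss
  -- of 1 in each of two coordinates gives its factor exp(2m).
  have h : ∀ t : ℝ, (t - x₀) ^ 2 / 2 - 1 ≤ (t - z.1) ^ 2 := fun t => by
    nlinarith [sq_nonneg ((t - z.1) - (z.1 - x₀))]
  nlinarith [mul_le_mul_of_nonneg_left (h p.1) hm.le, mul_le_mul_of_nonneg_left (h p.2) hm.le]

theorem continuous_krausKernel_uncurry (μ : ℝ) (z : ℝ × ℝ) :
    Continuous (Function.uncurry (krausKernel μ z)) :=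
  (continuous_krausKernel μ).comp (f := fun p : ℝ × ℝ => (z, p)) (by fun_prop)

theorem memLp_krausKernel (hμ : 1 / 2 ≤ μ) (z : ℝ × ℝ) :
    MemLp (Function.uncurry (krausKernel μ z)) 2 (volume.prod volume) :=
  (memLp_krausBound hμ z.1).mono' (continuous_krausKernel_uncurry μ z).aestronglyMeasurable
    (Eventually.of_forall fun p => norm_krausKernel_le hμ (by simp) p)

variable {A : Type*} [NormedAddCommGroup A] [InnerProductSpace ℂ A]

theorem continuous_krausOp (hμ : 1 / 2 ≤ μ) : Continuous (krausOp A μ) := by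
  refine continuous_iff_continuousAt.2 fun z₀ => ?_
  refine (tendsto_iff_norm_sub_tendsto_zero (E := Joint A →L[ℂ] Joint A)).2 ?_
  have hnear : ∀ᶠ z : ℝ × ℝ in 𝓝 z₀, |z.1 - z₀.1| ≤ 1 := by
    have h : Tendsto (fun z : ℝ × ℝ => |z.1 - z₀.1|) (𝓝 z₀) (𝓝 0) := by
      have : Continuous fun z : ℝ × ℝ => |z.1 - z₀.1| := by fun_prop
      simpa using this.tendsto z₀
    exact (h.eventually (gt_mem_nhds zero_lt_one)).mono fun z hz => le_of_lt hz
  have h := tendsto_eLpNorm_sub_of_dominated (μ := (volume.prod volume : Measure (ℝ × ℝ)))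
    (F := fun z p => Function.uncurry (krausKernel μ z) p) (x₀ := z₀)
    (fun z => (continuous_krausKernel_uncurry μ z).aestronglyMeasurable)
    (fun p => ((continuous_krausKernel μ).comp (f := fun z => (z, p)) (by fun_prop)).continuousAt)
    (memLp_krausBound hμ z₀.1) (hnear.mono fun z hz p => norm_krausKernel_le hμ hz p)
  have h' := (ENNReal.tendsto_toReal ENNReal.zero_ne_top).comp h
  exact squeeze_zero (fun z => norm_nonneg (krausOp A μ z - krausOp A μ z₀))
    (fun z => norm_kernelOp_sub_le (memLp_krausKernel hμ z) (memLp_krausKernel hμ z₀)) h'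

theorem enorm_kernelOp_sq {k : ℝ → ℝ → ℂ}
    (hk : MemLp (Function.uncurry k) 2 (volume.prod volume)) (f : Joint A) :
    ‖kernelOp A k f‖ₑ ^ 2 = ∫⁻ b, ‖∫ q, k b q • f q‖ₑ ^ 2 := by
  rw [Lp.enorm_def, eLpNorm_congr_ae (coeFn_kernelOp hk f), eLpNorm_two_sq]

variable [CompleteSpace A]

/-- For fixed x and b the integral over q is, up to a unit phase, (2π)^{-1/2} times a Fourier
transform at y. Plancherel gives a factor 2π that cancels the normalisation. -/
theorem lintegral_enorm_krausKernel_sq (hμ : 1 / 2 ≤ μ) (f : Joint A) (x b : ℝ) :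
    ∫⁻ y : ℝ, ‖∫ q, krausKernel μ (x, y) b q • f q‖ₑ ^ 2 =
      ∫⁻ q, ENNReal.ofReal (tmsvAmp μ (q - x) (b - x) ^ 2) * ‖f q‖ₑ ^ 2 := by
  have hpi := Real.pi_pos
  have hc : Continuous fun q => tmsvWave μ (q - x) (b - x) :=
    (continuous_tmsvWave_left μ (b - x)).comp (continuous_sub_right x)
  have hw : MemLp (fun q => tmsvWave μ (q - x) (b - x)) 2 := by
    have h := (memLp_tmsvWave hμ (b - x)).comp_measurePreserving
      (measurePreserving_sub_right volume x)
    exact h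
  have h1 : Integrable fun q => tmsvWave μ (q - x) (b - x) • f q :=
    memLp_one_iff_integrable.1 ((Lp.memLp f).smul (r := 1) hw)
  have h2 : MemLp (fun q => tmsvWave μ (q - x) (b - x) • f q) 2 := by
    refine ((Lp.memLp f).norm.const_mul ((√Real.pi)⁻¹)).mono'
      (hc.aestronglyMeasurable.smul (Lp.aestronglyMeasurable f)) (Eventually.of_forall fun q => ?_)
    rw [norm_smul]
    gcongr
    refine (norm_tmsvWave_le hμ _ _).trans (mul_le_of_le_one_right (by positivity) ?_)
    rw [Real.exp_le_one_iff]
    nlinarith [sq_nonneg (q - x), sqrt_sub_lt hμ]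
  have h3 : ∀ y : ℝ, ‖∫ q, krausKernel μ (x, y) b q • f q‖ₑ ^ 2 =
      ENNReal.ofReal (2 * Real.pi)⁻¹ * ‖∫ q : ℝ, Complex.exp (-(Complex.I * y * q)) •
        (tmsvWave μ (q - x) (b - x) • f q)‖ₑ ^ 2 := fun y => by
    simp_rw [krausKernel_eq, mul_smul, integral_smul]
    rw [enorm_smul, enorm_smul, mul_pow, mul_pow]
    have e1 : ‖Complex.exp (Complex.I * (y * b - x * y / 2))‖ₑ = 1 := by
      rw [← ofReal_norm, Complex.norm_exp]
      simp [Complex.mul_re]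
    have e2 : ‖(((√(2 * Real.pi))⁻¹ : ℝ) : ℂ)‖ₑ ^ 2 = ENNReal.ofReal (2 * Real.pi)⁻¹ := by
      rw [← ofReal_norm_sq, Complex.norm_real, Real.norm_of_nonneg (by positivity), inv_pow,
        Real.sq_sqrt (by positivity)]
    rw [e1, e2, one_pow, one_mul]
  simp_rw [h3]
  rw [lintegral_const_mul' _ _ ENNReal.ofReal_ne_top, lintegral_enorm_integral_exp_sq h1 h2,
    ← mul_assoc, ← ENNReal.ofReal_mul (by positivity), inv_mul_cancel₀ (by positivity),
    ENNReal.ofReal_one, one_mul]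
  refine lintegral_congr fun q => ?_
  rw [enorm_smul, mul_pow, ← ofReal_norm_sq, norm_tmsvWave]

/-- The Kraus operators of the BK protocol satisfy `∫ K_z† K_z dz = 1`. -/
theorem lintegral_enorm_krausOp_sq (hμ : 1 / 2 ≤ μ) (f : Joint A) :
    ∫⁻ z, ‖krausOp A μ z f‖ₑ ^ 2 = ‖f‖ₑ ^ 2 := by
  have hcont : Continuous fun z => krausOp A μ z f :=
    (continuous_krausOp hμ).clm_apply continuous_const
  have hfm : Measurable fun q => ‖f q‖ₑ ^ 2 := (Lp.stronglyMeasurable f).enorm.pow_const 2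
  rw [Measure.volume_eq_prod, lintegral_prod _ (hcont.enorm.measurable.pow_const 2).aemeasurable]
  have hswap : ∀ x : ℝ, ∫⁻ y : ℝ, ‖krausOp A μ (x, y) f‖ₑ ^ 2 =
      ∫⁻ b : ℝ, ∫⁻ q, ENNReal.ofReal (tmsvAmp μ (q - x) (b - x) ^ 2) * ‖f q‖ₑ ^ 2 := fun x => by
    simp_rw [krausOp_eq, fun y => enorm_kernelOp_sq (memLp_krausKernel hμ (x, y)) f]
    rw [lintegral_lintegral_swap]
    · exact lintegral_congr fun b => lintegral_enorm_krausKernel_sq hμ f x b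
    · have h1 : StronglyMeasurable fun p : (ℝ × ℝ) × ℝ =>
          krausKernel μ (x, p.1.1) p.1.2 p.2 • f p.2 := by
        refine StronglyMeasurable.smul ?_
          ((Lp.stronglyMeasurable f).comp_measurable measurable_snd)
        exact ((continuous_krausKernel μ).comp (f := fun p : (ℝ × ℝ) × ℝ =>
          ((x, p.1.1), (p.1.2, p.2))) (by fun_prop)).stronglyMeasurable
      exact (h1.integral_prod_right'.enorm.pow_const 2).aemeasurable
  have hamp : Continuous fun p : (ℝ × ℝ) × ℝ => tmsvAmp μ (p.2 - p.1.1) (p.1.2 - p.1.1) :=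
    (continuous_tmsvAmp μ).comp (f := fun p : (ℝ × ℝ) × ℝ => (p.2 - p.1.1, p.1.2 - p.1.1))
      (by fun_prop)
  -- Integrating out b leaves the position density of one resource mode at q - x; the integral over
  -- x below then gives total mass 1.
  have hinner : ∀ x : ℝ, ∫⁻ b : ℝ, ∫⁻ q, ENNReal.ofReal (tmsvAmp μ (q - x) (b - x) ^ 2) *
      ‖f q‖ₑ ^ 2 = ∫⁻ q, ENNReal.ofReal ((√(2 * Real.pi * μ))⁻¹ *
        Real.exp (-(1 / (2 * μ)) * (q - x) ^ 2)) * ‖f q‖ₑ ^ 2 := fun x => by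
    rw [lintegral_lintegral_swap]
    · refine lintegral_congr fun q => ?_
      rw [lintegral_mul_const' _ _ (by simp)]
      congr 1
      simp_rw [tmsvAmp_comm μ (q - x)]
      rw [lintegral_sub_right_eq_self (fun b => ENNReal.ofReal (tmsvAmp μ b (q - x) ^ 2)) x,
        lintegral_ofReal_tmsvAmp_sq hμ]
    · have h1 : Continuous fun p : ℝ × ℝ => tmsvAmp μ (p.2 - x) (p.1 - x) ^ 2 :=
        (hamp.comp (f := fun p : ℝ × ℝ => ((x, p.1), p.2)) (by fun_prop)).pow 2
      exact (h1.measurable.ennreal_ofReal.mul (hfm.comp measurable_snd)).aemeasurable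
  simp_rw [hswap, hinner]
  rw [lintegral_lintegral_swap]
  · rw [Lp.enorm_def, eLpNorm_two_sq]
    refine lintegral_congr fun q => ?_
    rw [lintegral_mul_const' _ _ (by simp), lintegral_sub_left_eq_self (fun x : ℝ =>
      ENNReal.ofReal ((√(2 * Real.pi * μ))⁻¹ * Real.exp (-(1 / (2 * μ)) * x ^ 2))) q,
      lintegral_tmsv_marginal hμ, one_mul]
  · have h1 : Continuous fun p : ℝ × ℝ =>
        (√(2 * Real.pi * μ))⁻¹ * Real.exp (-(1 / (2 * μ)) * (p.2 - p.1) ^ 2) := by fun_prop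
    exact (h1.measurable.ennreal_ofReal.mul (hfm.comp measurable_snd)).aemeasurable

theorem isState_bkChannel (hμ : 1 / 2 ≤ μ) {A : Type} [NormedAddCommGroup A]
    [InnerProductSpace ℂ A] [CompleteSpace A] {ρ : Joint A →L[ℂ] Joint A} (hρ : IsState ρ) :
    IsState (bkChannel μ A ρ) :=
  isState_integral_kraus_conj (continuous_krausOp hμ) (lintegral_enorm_krausOp_sq hμ) hρ

theorem inner_bkChannel_pureOp (hμ : 1 / 2 ≤ μ) {A : Type} [NormedAddCommGroup A]
    [InnerProductSpace ℂ A] [CompleteSpace A] {ψ : Joint A} (hψ : ‖ψ‖ = 1) (φ : Joint A) :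
    inner ℂ φ (bkChannel μ A (pureOp ψ) φ) =
      ((∫ z, ‖inner ℂ φ (krausOp A μ z ψ)‖ ^ 2 : ℝ) : ℂ) := by
  have h := inner_integral_kraus_conj_pureOp (continuous_krausOp (A := A) hμ)
    (lintegral_enorm_krausOp_sq hμ) hψ φ
  have e : bkChannel μ A (pureOp ψ) = ∫ z, (krausOp A μ z).comp ((pureOp ψ).comp
    (ContinuousLinearMap.adjoint (krausOp A μ z))) := rfl
  rw [e]
  exact h

end Kraus

end BK

namespace BK

/-! ### Overlap of a TMSV input with its teleported image -/

section Overlap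

/-- The change of variables t = b + q, r = b - q has Jacobian 1/2. It is carried out as the integral
of a convolution of P(2·) and Q(2·). -/
theorem integral_integral_add_mul_sub {P Q : ℝ → ℂ} (hP : Integrable P) (hQ : Integrable Q) :
    ∫ b, ∫ q, P (b + q) * Q (b - q) = 1 / 2 * ((∫ t, P t) * ∫ r, Q r) := by
  have hP2 : Integrable fun t => P (2 * t) := hP.comp_mul_left' two_ne_zero
  have hQ2 : Integrable fun t => Q (2 * t) := hQ.comp_mul_left' two_ne_zero
  have h1 : ∀ b, ∫ q, P (b + q) * Q (b - q) = 2 * ∫ s, Q (2 * s) * P (2 * (b - s)) := fun b => by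
    have e1 := integral_sub_left_eq_self (fun r => P (2 * b - r) * Q r) volume b
    have e2 := Measure.integral_comp_mul_left (fun r => P (2 * b - r) * Q r) 2
    calc ∫ q, P (b + q) * Q (b - q) = ∫ q, P (2 * b - (b - q)) * Q (b - q) := by
          congr 1; ext q; congr 2; ring
      _ = ∫ r, P (2 * b - r) * Q r := e1
      _ = 2 * ∫ s, P (2 * b - 2 * s) * Q (2 * s) := by
          rw [e2, abs_of_pos (by norm_num), Complex.real_smul]; push_cast; ring
      _ = _ := by
          congr 2; ext s; rw [mul_comm, mul_sub]
  have h2 := integral_convolution (ContinuousLinearMap.mul ℂ ℂ) hQ2 hP2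
    (μ := (volume : Measure ℝ)) (ν := volume)
  simp only [convolution_def, ContinuousLinearMap.mul_apply'] at h2
  simp_rw [h1]
  rw [integral_const_mul, h2, Measure.integral_comp_mul_left, Measure.integral_comp_mul_left,
    abs_of_pos (by norm_num), Complex.real_smul, Complex.real_smul]
  push_cast
  ring

variable {μ ν : ℝ}

/-- Only mode a is acted on, so the overlap sees ψ solely through the kernel of its reduced state.
-/
theorem inner_tmsvVec_krausOp (hμ : 1 / 2 ≤ μ) (hν : 1 / 2 ≤ ν) (z : ℝ × ℝ) :
    inner ℂ (tmsvVec ν) (krausOp Mode μ z (tmsvVec ν)) =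
      ∫ b, ∫ q, krausKernel μ z b q * inner ℂ (tmsvSlice ν b) (tmsvSlice ν q) := by
  have hk := memLp_krausKernel hμ z
  have hψ : ⇑(tmsvVec ν) =ᵐ[volume] tmsvSlice ν := by
    rw [tmsvVec_eq hν]; exact MemLp.coeFn_toLp _
  rw [krausOp_eq, inner_kernelOp hk]
  refine integral_congr_ae ?_
  filter_upwards [hψ] with b h1
  refine integral_congr_ae ?_
  filter_upwards [hψ] with q hq
  rw [h1, hq]

/-- The quadratic form is diagonal in the sum and difference of the positions. -/
theorem tmsvAmp_eq (μ a b : ℝ) : tmsvAmp μ a b = (√Real.pi)⁻¹ *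
    (Real.exp (-((μ - √(μ ^ 2 - 1 / 4)) / 2) * (a + b) ^ 2) *
      Real.exp (-((μ + √(μ ^ 2 - 1 / 4)) / 2) * (a - b) ^ 2)) := by
  rw [tmsvAmp, ← Real.exp_add]
  congr 2
  ring

/-- The overlap of a TMSV input with its image under a Kraus operator of the BK protocol. -/
theorem norm_inner_tmsvVec_krausOp_sq (hμ : 1 / 2 ≤ μ) (hν : 1 / 2 ≤ ν) {m T : ℝ}
    (hm : m = μ - √(μ ^ 2 - 1 / 4)) (hT : T = 1 + 4 * ν * m) (z : ℝ × ℝ) :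
    ‖inner ℂ (tmsvVec ν) (krausOp Mode μ z (tmsvVec ν))‖ ^ 2 = 4 * m / (Real.pi * T ^ 2) *
      (Real.exp (-(4 * m / T) * z.1 ^ 2) * Real.exp (-(4 * m / T) * z.2 ^ 2)) := by
  obtain ⟨x, y⟩ := z
  have hpi := Real.pi_pos
  have hν0 : 0 < ν := by linarith
  have hm0 : 0 < m := hm ▸ sub_pos.2 (sqrt_sub_lt hμ)
  have hT0 : 0 < T := by rw [hT]; positivity
  -- From (μ - c)(μ + c) = 1/4 with c = √(μ² - 1/4).
  have hM : μ + √(μ ^ 2 - 1 / 4) = 1 / (4 * m) := by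
    rw [eq_div_iff (by positivity), hm]
    linear_combination (-4 : ℝ) * sq_sqrt_sub hμ
  -- P collects the dependence on t = b + q: the resource gives -(m/2)(t - 2x)² and the reduced
  -- input -t²/(8ν). Q collects r = b - q: -r²/(8m) - νr²/2 and the phase exp(iyr).
  set P : ℝ → ℝ := fun t => Real.exp (-(T / (8 * ν)) * t ^ 2 + 2 * m * x * t + -(2 * m * x ^ 2))
    with hPdef
  set Q : ℝ → ℂ := fun r => Complex.exp (Complex.I * y * r) *
    Complex.exp (-((T / (8 * m) : ℝ) : ℂ) * r ^ 2) with hQdef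
  set C : ℂ := Complex.exp (-(Complex.I * (x * y / 2))) *
    ((((√(2 * Real.pi))⁻¹ * (√Real.pi)⁻¹ * (√(2 * Real.pi * ν))⁻¹ : ℝ)) : ℂ) with hCdef
  have ha : 0 < T / (8 * ν) := by positivity
  have hb : 0 < T / (8 * m) := by positivity
  have hb' : 0 < (((T / (8 * m) : ℝ) : ℂ)).re := by
    rw [Complex.ofReal_re]; exact hb
  have hP : Integrable P := integrable_exp_quadratic ha _ _
  have hQ : Integrable Q := by
    have h := integrable_cexp_quadratic hb' (Complex.I * y) 0
    refine h.congr (Eventually.of_forall fun r => ?_)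
    simp only [hQdef, ← Complex.exp_add]
    congr 1
    ring
  have hkey : ∀ b q, krausKernel μ (x, y) b q * inner ℂ (tmsvSlice ν b) (tmsvSlice ν q) =
      C * ((P (b + q) : ℂ) * Q (b - q)) := fun b q => by
    have e1 : tmsvAmp μ (q - x) (b - x) * ((√(2 * Real.pi * ν))⁻¹ *
        (Real.exp (-(1 / (8 * ν)) * (b + q) ^ 2) * Real.exp (-(ν / 2) * (b - q) ^ 2))) =
        (√Real.pi)⁻¹ * (√(2 * Real.pi * ν))⁻¹ *
          (P (b + q) * Real.exp (-(T / (8 * m)) * (b - q) ^ 2)) := by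
      rw [tmsvAmp_eq, hM, ← hm, hPdef, mul_mul_mul_comm]
      congr 1
      simp only [← Real.exp_add]
      congr 1
      rw [hT]
      field_simp
      ring
    have e2 := congrArg (fun t : ℝ => (t : ℂ)) e1
    simp only [Complex.ofReal_mul] at e2
    have e3 : Complex.exp (Complex.I * (y * b - x * y / 2)) * Complex.exp (-(Complex.I * y * q)) =
        Complex.exp (-(Complex.I * (x * y / 2))) *
          Complex.exp (Complex.I * y * ((b - q : ℝ) : ℂ)) := by
      rw [← Complex.exp_add, ← Complex.exp_add]
      congr 1
      push_cast
      ring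
    have e4 : ((Real.exp (-(T / (8 * m)) * (b - q) ^ 2) : ℝ) : ℂ) =
        Complex.exp (-((T / (8 * m) : ℝ) : ℂ) * ((b - q : ℝ) : ℂ) ^ 2) := by
      push_cast; rfl
    rw [krausKernel_eq, inner_tmsvSlice hν, tmsvWave_eq, hCdef, hQdef]
    simp only [Complex.ofReal_mul]
    rw [← e4]
    linear_combination ((((√(2 * Real.pi))⁻¹ : ℝ)) : ℂ) *
      (Complex.exp (Complex.I * (y * b - x * y / 2)) * Complex.exp (-(Complex.I * y * q)) * e2 +
        ((√Real.pi)⁻¹ : ℝ) * ((√(2 * Real.pi * ν))⁻¹ : ℝ) * (P (b + q) : ℂ) *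
          ((Real.exp (-(T / (8 * m)) * (b - q) ^ 2) : ℝ) : ℂ) * e3)
  have hPi : ∫ t, (P t : ℂ) = ((√(Real.pi / (T / (8 * ν))) *
      Real.exp (-(2 * m * x ^ 2) + (2 * m * x) ^ 2 / (4 * (T / (8 * ν)))) : ℝ) : ℂ) := by
    rw [integral_complex_ofReal, hPdef, integral_exp_quadratic ha]
  have hQi : ∫ r, Q r = ((√(Real.pi / (T / (8 * m))) *
      Real.exp (-y ^ 2 / (4 * (T / (8 * m)))) : ℝ) : ℂ) := by
    rw [hQdef, fourierIntegral_gaussian hb', Real.sqrt_eq_rpow, Complex.ofReal_mul,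
      Complex.ofReal_cpow (by positivity)]
    push_cast
    rfl
  rw [inner_tmsvVec_krausOp hμ hν]
  simp_rw [hkey, integral_const_mul]
  rw [integral_integral_add_mul_sub (P := fun t => (P t : ℂ)) hP.ofReal hQ, hPi, hQi, ← Complex.ofReal_mul, hCdef]
  have hph : ‖Complex.exp (-(Complex.I * (x * y / 2)))‖ = 1 := by
    rw [Complex.norm_exp]
    simp [Complex.mul_re]
  have hhalf : ‖(1 / 2 : ℂ)‖ = 1 / 2 := by norm_num
  rw [norm_mul, norm_mul, norm_mul, hph, hhalf, Complex.norm_real, Complex.norm_real, Real.norm_eq_abs,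
    Real.norm_eq_abs, abs_of_pos (by positivity), abs_of_pos (by positivity)]
  simp only [one_mul, mul_pow, inv_pow, one_div]
  rw [Real.sq_sqrt (by positivity), Real.sq_sqrt (by positivity), Real.sq_sqrt (by positivity),
    Real.sq_sqrt (by positivity), Real.sq_sqrt (by positivity), ← Real.exp_nat_mul,
    ← Real.exp_nat_mul]
  have hx : ((2 : ℕ) : ℝ) * (-(2 * m * x ^ 2) + 2 ^ 2 * m ^ 2 * x ^ 2 / (4 * (T / (8 * ν)))) =
      -(4 * m / T) * x ^ 2 := by
    rw [hT]
    have : 1 + 4 * ν * m ≠ 0 := by rw [← hT]; exact hT0.ne'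
    field_simp
    push_cast
    ring
  have hy : ((2 : ℕ) : ℝ) * (-y ^ 2 / (4 * (T / (8 * m)))) = -(4 * m / T) * y ^ 2 := by
    field_simp
    push_cast
    ring
  rw [hx, hy]
  field_simp
  ring

theorem integral_norm_inner_tmsvVec_krausOp_sq (hμ : 1 / 2 ≤ μ) (hν : 1 / 2 ≤ ν) {m T : ℝ}
    (hm : m = μ - √(μ ^ 2 - 1 / 4)) (hT : T = 1 + 4 * ν * m) :
    ∫ z, ‖inner ℂ (tmsvVec ν) (krausOp Mode μ z (tmsvVec ν))‖ ^ 2 = 1 / T := by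
  have hpi := Real.pi_pos
  have hν0 : 0 < ν := by linarith
  have hm0 : 0 < m := hm ▸ sub_pos.2 (sqrt_sub_lt hμ)
  have hT0 : 0 < T := by rw [hT]; positivity
  simp_rw [norm_inner_tmsvVec_krausOp_sq hμ hν hm hT]
  rw [integral_const_mul, Measure.volume_eq_prod,
    integral_prod_mul (fun x : ℝ => Real.exp (-(4 * m / T) * x ^ 2))
      (fun y : ℝ => Real.exp (-(4 * m / T) * y ^ 2)), integral_gaussian,
    Real.mul_self_sqrt (by positivity)]
  field_simp

end Overlap

/-! ### Closed form, limits and failure of uniform convergence -/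

section Fidelity

variable {μ ν : ℝ}

theorem sqrt_four_mul_sq_sub_one (μ : ℝ) : √(4 * μ ^ 2 - 1) = 2 * √(μ ^ 2 - 1 / 4) := by
  have h : 4 * μ ^ 2 - 1 = 2 ^ 2 * (μ ^ 2 - 1 / 4) := by ring
  rw [h, Real.sqrt_mul (by norm_num), Real.sqrt_sq (by norm_num)]

theorem addedNoise_eq (μ : ℝ) : addedNoise μ = 2 * (μ - √(μ ^ 2 - 1 / 4)) := by
  rw [addedNoise, sqrt_four_mul_sq_sub_one]; ring

theorem addedNoise_pos (hμ : 1 / 2 ≤ μ) : 0 < addedNoise μ := by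
  rw [addedNoise_eq]
  linarith [sqrt_sub_lt hμ]

/-- By (μ - c)(μ + c) = 1/4 with c = √(μ² - 1/4), ξ equals 1/(2(μ + c)). -/
theorem addedNoise_le (hμ : 1 / 2 ≤ μ) : addedNoise μ ≤ μ⁻¹ := by
  rw [addedNoise_eq, ← one_div, le_div_iff₀ (by linarith)]
  nlinarith [sq_sqrt_sub hμ, Real.sqrt_nonneg (μ ^ 2 - 1 / 4), sqrt_sub_lt hμ]

theorem re_inner_bkChannel_tmsv (hμ : 1 / 2 ≤ μ) (hν : 1 / 2 ≤ ν) :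
    (inner ℂ (tmsvVec ν) (bkChannel μ Mode (tmsv ν) (tmsvVec ν))).re =
      1 / (1 + 2 * ν * addedNoise μ) := by
  rw [tmsv, inner_bkChannel_pureOp hμ (norm_tmsvVec hν), Complex.ofReal_re,
    integral_norm_inner_tmsvVec_krausOp_sq hμ hν rfl rfl, addedNoise_eq]
  ring_nf

theorem tmsvFidelity_eq (hμ : 1 / 2 ≤ μ) (hν : 1 / 2 ≤ ν) :
    tmsvFidelity μ ν = √(1 / (1 + 2 * ν * addedNoise μ)) := by
  rw [← re_inner_bkChannel_tmsv hμ hν]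
  exact fidelity_pureOp (isState_bkChannel hμ (isState_tmsv hν)).1 _

/-- A perfect square because ξ² = 4μξ - 1. The fourth root of the radicand is thus √(1 + 2νξ). -/
theorem fidelity_radicand_eq (hμ : 1 / 2 ≤ μ) (ν : ℝ) :
    1 - 4 * ν * (√(4 * μ ^ 2 - 1) + ν - 2 * μ * (1 + 2 * ν * addedNoise μ)) =
      (1 + 2 * ν * addedNoise μ) ^ 2 := by
  rw [sqrt_four_mul_sq_sub_one, addedNoise_eq]
  linear_combination (-16 * ν ^ 2) * sq_sqrt_sub hμ

theorem tmsvFidelity_nonneg (μ ν : ℝ) : 0 ≤ tmsvFidelity μ ν := ENNReal.toReal_nonneg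

theorem one_sub_tmsvFidelity_mem (hμ : 1 / 2 ≤ μ) (hν : 1 / 2 ≤ ν) :
    0 ≤ 1 - tmsvFidelity μ ν ∧ 1 - tmsvFidelity μ ν ≤ 2 * ν * μ⁻¹ := by
  have hξ := addedNoise_pos hμ
  have hν0 : 0 < ν := by linarith
  set t := 2 * ν * addedNoise μ with ht
  have ht0 : 0 < t := by positivity
  have h1 : 1 / (1 + t) ≤ 1 := by rw [div_le_one (by positivity)]; linarith
  rw [tmsvFidelity_eq hμ hν]
  constructor
  · rw [sub_nonneg, Real.sqrt_le_one]; exact h1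
  · have h2 : 1 / (1 + t) ≤ √(1 / (1 + t)) := by
      rw [Real.le_sqrt (by positivity) (by positivity)]
      have : 0 ≤ 1 / (1 + t) := by positivity
      nlinarith
    have h3 : 1 - t ≤ 1 / (1 + t) := by
      rw [le_div_iff₀ (by positivity)]; nlinarith
    have h4 : t ≤ 2 * ν * μ⁻¹ := mul_le_mul_of_nonneg_left (addedNoise_le hμ) (by positivity)
    linarith

theorem isBigO_one_sub_tmsvFidelity (hν : 1 / 2 ≤ ν) :
    (fun μ => 1 - tmsvFidelity μ ν) =O[atTop] (fun μ : ℝ => μ⁻¹) := by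
  refine IsBigO.of_bound (2 * ν) ?_
  filter_upwards [eventually_ge_atTop (1 / 2)] with μ hμ
  obtain ⟨h0, h1⟩ := one_sub_tmsvFidelity_mem hμ hν
  rwa [Real.norm_of_nonneg h0, Real.norm_of_nonneg (inv_nonneg.2 (by linarith))]

theorem tendsto_tmsvFidelity_one (hν : 1 / 2 ≤ ν) :
    Tendsto (fun μ => tmsvFidelity μ ν) atTop (𝓝 1) := by
  have h := (isBigO_one_sub_tmsvFidelity hν).trans_tendsto tendsto_inv_atTop_zero
  simpa using h.const_sub 1

/-- Dropping the 1 gives F² ≤ 1/(2νξ), where ξ > 0 is fixed. -/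
theorem isBigO_tmsvFidelity (hμ : 1 / 2 ≤ μ) :
    (fun ν => tmsvFidelity μ ν) =O[atTop] (fun ν : ℝ => ν ^ (-(1 / 2) : ℝ)) := by
  have hξ := addedNoise_pos hμ
  refine IsBigO.of_bound √(1 / (2 * addedNoise μ)) ?_
  filter_upwards [eventually_ge_atTop (1 / 2)] with ν hν
  have hν0 : 0 < ν := by linarith
  rw [Real.norm_of_nonneg (tmsvFidelity_nonneg μ ν), Real.norm_of_nonneg (by positivity),
    tmsvFidelity_eq hμ hν, Real.rpow_neg hν0.le, ← Real.sqrt_eq_rpow, ← Real.sqrt_inv,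
    ← Real.sqrt_mul (by positivity)]
  refine Real.sqrt_le_sqrt ?_
  rw [← one_div ν, div_mul_div_comm]
  exact div_le_div₀ (by norm_num) (by norm_num) (by positivity) (by nlinarith)

theorem tendsto_tmsvFidelity_zero (hμ : 1 / 2 ≤ μ) :
    Tendsto (fun ν => tmsvFidelity μ ν) atTop (𝓝 0) :=
  (isBigO_tmsvFidelity hμ).trans_tendsto (tendsto_rpow_neg_atTop (by norm_num))

/-- Fidelities are nonnegative, so 1 is an upper bound; TMSV inputs with ν → ∞ approach it. -/
theorem isLUB_infidelities (hμ : 1 / 2 ≤ μ) : IsLUB (infidelities μ) 1 := by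
  constructor
  · rintro _ ⟨A, _, _, _, ρ, _, rfl⟩
    exact sub_le_self _ ENNReal.toReal_nonneg
  · intro B hB
    have h : Tendsto (fun ν => 1 - tmsvFidelity μ ν) atTop (𝓝 1) := by
      simpa using (tendsto_tmsvFidelity_zero hμ).const_sub 1
    refine le_of_tendsto h ?_
    filter_upwards [eventually_ge_atTop (1 / 2)] with ν hν
    exact hB ⟨Mode, inferInstance, inferInstance, inferInstance, tmsv ν, isState_tmsv hν, rfl⟩

theorem diamondDist_idChannel_bkChannel (hμ : 1 / 2 ≤ μ) :
    diamondDist idChannel (bkChannel μ) = 2 := by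
  refine le_antisymm ?_ ?_
  · refine iSup_le fun A => iSup_le fun _ => iSup_le fun _ => iSup_le fun _ => iSup_le fun ρ =>
      iSup_le fun hρ => ?_
    exact traceNorm_sub_le_two hρ (isState_bkChannel hμ hρ)
  -- The pure-state bound 2(1 - F²) on TMSV inputs tends to 2 as ν → ∞.
  · have h : Tendsto (fun ν => ENNReal.ofReal (2 * (1 - tmsvFidelity μ ν ^ 2))) atTop (𝓝 2) := by
      have h1 := (((tendsto_tmsvFidelity_zero hμ).pow 2).const_sub 1).const_mul 2
      have h2 := ENNReal.tendsto_ofReal h1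
      simpa using h2
    refine le_of_tendsto h ?_
    filter_upwards [eventually_ge_atTop (1 / 2)] with ν hν
    have hξ := addedNoise_pos hμ
    have hsq : tmsvFidelity μ ν ^ 2 =
        (inner ℂ (tmsvVec ν) (bkChannel μ Mode (tmsv ν) (tmsvVec ν))).re := by
      have hν0 : 0 < ν := by linarith
      rw [re_inner_bkChannel_tmsv hμ hν, tmsvFidelity_eq hμ hν, Real.sq_sqrt (by positivity)]
    rw [hsq]
    refine (le_traceNorm_pureOp_sub (isState_bkChannel hμ (isState_tmsv hν))
      (norm_tmsvVec hν)).trans ?_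
    unfold diamondDist
    exact le_iSup_of_le Mode <| le_iSup_of_le inferInstance <| le_iSup_of_le inferInstance <|
      le_iSup_of_le inferInstance <| le_iSup_of_le (tmsv ν) <|
        le_iSup_of_le (isState_tmsv hν) le_rfl

end Fidelity

end BK

theorem mainTheorem4 :
    -- the BK channel maps states to states, and the TMSV inputs are states
    (∀ μ : ℝ, 1 / 2 ≤ μ →
      ∀ (A : Type) [NormedAddCommGroup A] [InnerProductSpace ℂ A] [CompleteSpace A]
        (ρ : BK.Joint A →L[ℂ] BK.Joint A), BK.IsState ρ → BK.IsState (BK.bkChannel μ A ρ)) ∧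
    (∀ ν : ℝ, 1 / 2 ≤ ν → BK.IsState (BK.tmsv ν)) ∧
    -- closed form of the fidelity
    (∀ μ ν : ℝ, 1 / 2 ≤ μ → 1 / 2 ≤ ν →
      0 < 1 - 4 * ν * (Real.sqrt (4 * μ ^ 2 - 1) + ν
          - 2 * μ * (1 + 2 * ν * BK.addedNoise μ)) ∧
      BK.tmsvFidelity μ ν =
        1 / (1 - 4 * ν * (Real.sqrt (4 * μ ^ 2 - 1) + ν
          - 2 * μ * (1 + 2 * ν * BK.addedNoise μ))) ^ (1 / 4 : ℝ)) ∧
    -- fixed input, growing simulation energy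
    (∀ ν : ℝ, 1 / 2 ≤ ν →
      Tendsto (fun μ => BK.tmsvFidelity μ ν) atTop (𝓝 1) ∧
      (fun μ => 1 - BK.tmsvFidelity μ ν) =O[atTop] (fun μ : ℝ => μ⁻¹)) ∧
    -- fixed simulation energy, growing input energy
    (∀ μ : ℝ, 1 / 2 ≤ μ →
      Tendsto (fun ν => BK.tmsvFidelity μ ν) atTop (𝓝 0) ∧
      (fun ν => BK.tmsvFidelity μ ν) =O[atTop] (fun ν : ℝ => ν ^ (-(1 / 2) : ℝ))) ∧
    -- no uniform convergence: worst-case infidelity and diamond distance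
    (∀ μ : ℝ, 1 / 2 ≤ μ → IsLUB (BK.infidelities μ) 1) ∧
    (∀ μ : ℝ, 1 / 2 ≤ μ → BK.diamondDist BK.idChannel (BK.bkChannel μ) = 2) := by
  refine ⟨fun μ hμ A _ _ _ ρ hρ => BK.isState_bkChannel hμ hρ, fun ν hν => BK.isState_tmsv hν,
    fun μ ν hμ hν => ?_, fun ν hν => ⟨BK.tendsto_tmsvFidelity_one hν,
      BK.isBigO_one_sub_tmsvFidelity hν⟩, fun μ hμ => ⟨BK.tendsto_tmsvFidelity_zero hμ,
      BK.isBigO_tmsvFidelity hμ⟩, fun μ hμ => BK.isLUB_infidelities hμ,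
    fun μ hμ => BK.diamondDist_idChannel_bkChannel hμ⟩
  have hν0 : 0 < ν := by linarith
  have hξ := BK.addedNoise_pos hμ
  have hT : 0 < 1 + 2 * ν * BK.addedNoise μ := by positivity
  rw [BK.fidelity_radicand_eq hμ ν]
  refine ⟨by positivity, ?_⟩
  rw [BK.tmsvFidelity_eq hμ hν, ← Real.rpow_natCast, ← Real.rpow_mul hT.le, Real.sqrt_div one_pos.le,
    Real.sqrt_one, Real.sqrt_eq_rpow]
  norm_num
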